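/- Corollary 4. Let the macro base stations (BSs) form a homogeneous Poisson point process in $\mathbb{R}^2$ of density $\lambda_1>0$. Each BS stores a random set of files; the sets are independent over the BSs, and the $f$-th file ($1\le f\le H_c$, where $H_c$ is the number of files cached in the network) is stored at a BS with probability $p_{1,f}\in[0,1]$. Each BS transmits with power $P_1>0$ from $N_1\ge 1$ antenna elements, the path loss is $L_1(r)=C_1r^{-\alpha_1}$ with $C_1>0$, $\alpha_1>2$, and the links to the origin have independent Rayleigh fading, $|h_x|^2\sim\mathrm{Exp}(1)$; locations, stored sets and fading are mutually independent. A user at the origin requesting file $f$ is served by the nearest BS $x_0$ that stores $f$, with $$\Upsilon_{1,f}=\frac{P_1L_1(\|x_0\|)N_1|h_{x_0}|^2}{\sigma_1^2+\sum_{x\ne x_0}P_1L_1(\|x\|)N_1|h_x|^2},$$ the sum being over all other BSs, whether or not they store $f$. In the interference-limited case $\sigma_1^2=0$, for every $\tau\ge 0$ (with $\tau>0$ if $p_{1,f}=0$), the coverage probability $P_{\Upsilon_{1,f}}(\tau)$, that is, the probability that there is a serving BS and $\Upsilon_{1,f}>\tau$, equals $$P_{\Upsilon_{1,f}}(\tau)=\frac{p_{1,f}}{p_{1,f}S_1^0(\tau)+(1-p_{1,f})\Delta_1(\tau)},$$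 where $S_1^0(\tau)={}_2F_1\left(-\tfrac{2}{\alpha_1},1;1-\tfrac{2}{\alpha_1};-\tau\right)$, with ${}_2F_1$ the (analytically continued) Gauss hypergeometric function, and $\Delta_1(\tau)=\Gamma\left(1-\tfrac{2}{\alpha_1}\right)\Gamma\left(1+\tfrac{2}{\alpha_1}\right)\tau^{2/\alpha_1}$. In particular, for given $\alpha_1$, $p_{1,f}$ and $\tau$, this probability is the same for all values of $\lambda_1$, $P_1$, $N_1$ and $C_1$. -/

import Mathlib

open MeasureTheory ProbabilityTheory
open scoped ENNReal

noncomputable section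

/-- The Gauss hypergeometric function `₂F₁(a, b; c; x)` for real parameters and real `x < 1`:
the analytic continuation to the half-line `(-∞, 1)` of the sum of the hypergeometric power series,
which converges on `(-1, 1)` only. The continuation is unique by the identity theorem. -/
def gaussHypergeometric (a b c x : ℝ) : ℝ :=
  open Classical in
  if h : ∃ g : ℝ → ℝ, AnalyticOnNhd ℝ g (Set.Iio 1) ∧
      ∀ y : ℝ, |y| < 1 → g y = ordinaryHypergeometric a b c y
  then h.choose x
  else 0

/-- Any analytic continuation of the hypergeometric series to `(-∞, 1)` is
`gaussHypergeometric`. -/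
theorem gaussHypergeometric_eq_of_analyticOnNhd {a b c : ℝ} {g : ℝ → ℝ}
    (hg : AnalyticOnNhd ℝ g (Set.Iio 1))
    (hs : ∀ y : ℝ, |y| < 1 → g y = ordinaryHypergeometric a b c y) {x : ℝ} (hx : x < 1) :
    gaussHypergeometric a b c x = g x := by
  have h : ∃ g : ℝ → ℝ, AnalyticOnNhd ℝ g (Set.Iio 1) ∧
      ∀ y : ℝ, |y| < 1 → g y = ordinaryHypergeometric a b c y := ⟨g, hg, hs⟩
  unfold gaussHypergeometric
  rw [dif_pos h]
  refine h.choose_spec.1.eqOn_of_preconnected_of_eventuallyEq hg isPreconnected_Iio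
    (z₀ := 0) (by simp) ?_ hx
  filter_upwards [Metric.ball_mem_nhds (0 : ℝ) one_pos] with y hy
  have hy' : |y| < 1 := by simpa using hy
  rw [h.choose_spec.2 y hy', hs y hy']

/-- `S^k(z) = ₂F₁(k - 2/α, k + Np; k + 1 - 2/α; -z)` for path loss exponent `α` and Nakagami
fading parameter `Np`. -/
def hypS (α : ℝ) (Np : ℕ) (k : ℕ) (z : ℝ) : ℝ :=
  gaussHypergeometric (k - 2 / α) (k + Np) (k + 1 - 2 / α) (-z)

/-- `Δ(z) = Γ(1 - 2/α) Γ(Np + 2/α) Γ(Np)⁻¹ z ^ (2/α)`. -/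
def gammaDelta (α : ℝ) (Np : ℕ) (z : ℝ) : ℝ :=
  Real.Gamma (1 - 2 / α) * Real.Gamma (Np + 2 / α) * (Real.Gamma Np)⁻¹ * z ^ (2 / α)

/-- The Nakagami parameter of the macro tier (Rayleigh fading). -/
def macroNakagami : ℕ := 1

/-- The directivity gain of the serving base station. -/
def maxGain : ℝ := 1

/-- The (omnidirectional) array gain of a macro base station. -/
def macroArrayGain : ℝ := 1

/-- The Euclidean plane. -/
abbrev Plane : Type := EuclideanSpace ℝ (Fin 2)

/-- The number of indices `n` with `X n ω ∈ A`, i.e. the number of points of the point process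
`∑ₙ δ_{X n}` in `A`, as an extended nonnegative real. -/
def pointCount {Ω : Type*} (X : ℕ → Ω → Plane) (A : Set Plane) (ω : Ω) : ℝ≥0∞ :=
  ∑' n, A.indicator (fun _ => (1 : ℝ≥0∞)) (X n ω)

/-- The random points `X 0, X 1, …` form a homogeneous Poisson point process of density `lam` on the
plane. -/
structure IsHomogeneousPoisson {Ω : Type*} [MeasurableSpace Ω] (μ : Measure Ω)
    (X : ℕ → Ω → Plane) (lam : ℝ) : Prop where
  measurable : ∀ n, Measurable (X n)
  poisson : ∀ A : Set Plane, MeasurableSet A → volume A ≠ ∞ → ∀ k : ℕ,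
    μ.real {ω | pointCount X A ω = k} =
      Real.exp (-(lam * volume.real A)) * (lam * volume.real A) ^ k / (k.factorial : ℝ)
  indep : ∀ (m : ℕ) (A : Fin m → Set Plane), (∀ i, MeasurableSet (A i)) →
    Pairwise (fun i j => Disjoint (A i) (A j)) →
    iIndepFun (fun i => pointCount X (A i)) μ

/-- The cache-enabled macro tier, seen from the typical user at the origin. -/
structure MacroTier {Ω : Type*} [MeasurableSpace Ω] (μ : Measure Ω) where
  /-- density of the macro base stations -/
  lam : ℝ
  lam_pos : 0 < lam
  /-- transmit power -/
  P : ℝ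
  P_pos : 0 < P
  /-- path loss intercept -/
  C : ℝ
  C_pos : 0 < C
  /-- path loss exponent -/
  α : ℝ
  two_lt_α : 2 < α
  /-- number of antenna elements -/
  N : ℕ
  N_pos : 0 < N
  /-- thermal noise power -/
  sigmaSq : ℝ
  sigmaSq_nonneg : 0 ≤ sigmaSq
  /-- the files `1, …, Hc` are cached in the network -/
  Hc : ℕ
  /-- `p f` is the probability that a base station caches the `f`-th file -/
  p : ℕ → ℝ
  /-- locations of the base stations -/
  X : ℕ → Ω → Plane
  /-- sets of files cached at the base stations -/
  cache : ℕ → Ω → Set ℕ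
  /-- small-scale fading coefficients of the links to the typical user -/
  h : ℕ → Ω → ℂ
  poisson : IsHomogeneousPoisson μ X lam
  cache_measurable : ∀ n, Measurable (cache n)
  cache_prob : ∀ n, ∀ f ∈ Finset.Icc 1 Hc, μ.real {ω | f ∈ cache n ω} = p f
  cache_indep : iIndepFun cache μ
  h_measurable : ∀ n, Measurable (h n)
  /-- Rayleigh fading: `|h|²` is exponentially distributed with mean one -/
  rayleigh : ∀ n, μ.map (fun ω => ‖h n ω‖ ^ 2) = expMeasure 1
  h_indep : iIndepFun h μ
  /-- locations, caches and fading are mutually independent (together with the next field) -/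
  indep_locations : IndepFun (fun ω n => X n ω) (fun ω => (fun n => cache n ω, fun n => h n ω)) μ
  indep_cache_fading : IndepFun (fun ω n => cache n ω) (fun ω n => h n ω) μ

namespace MacroTier

variable {Ω : Type*} [MeasurableSpace Ω] {μ : Measure Ω} (T : MacroTier μ)

/-- Path loss law `L(r) = C r ^ (-α)`. -/
def pathLoss (r : ℝ) : ℝ := T.C * r ^ (-T.α)

/-- Power received from the `m`-th base station as an interferer: `P L(‖x‖) H` with
`H = N |h|² G`. -/
def interferingPower (m : ℕ) (ω : Ω) : ℝ≥0∞ :=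
  ENNReal.ofReal (T.P * T.pathLoss ‖T.X m ω‖ * (T.N * ‖T.h m ω‖ ^ 2 * macroArrayGain))

open Classical in
/-- Interference from the base stations other than the `n`-th that cache file `f`. -/
def interferenceCached (f n : ℕ) (ω : Ω) : ℝ≥0∞ :=
  ∑' m, if m ≠ n ∧ f ∈ T.cache m ω then T.interferingPower m ω else 0

open Classical in
/-- Interference from the base stations that do not cache file `f`. -/
def interferenceUncached (f : ℕ) (ω : Ω) : ℝ≥0∞ :=
  ∑' m, if f ∉ T.cache m ω then T.interferingPower m ω else 0

/-- SINR at the typical user requesting file `f`, if served by the `n`-th base station. -/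
def sinr (f n : ℕ) (ω : Ω) : ℝ≥0∞ :=
  ENNReal.ofReal (T.P * T.pathLoss ‖T.X n ω‖ * maxGain * T.N * ‖T.h n ω‖ ^ 2) /
    (ENNReal.ofReal T.sigmaSq + T.interferenceCached f n ω + T.interferenceUncached f ω)

/-- The `n`-th base station serves the typical user requesting file `f`: it is a nearest one among
those that cache `f`. -/
def IsServing (f n : ℕ) (ω : Ω) : Prop :=
  f ∈ T.cache n ω ∧ ∀ m, f ∈ T.cache m ω → ‖T.X n ω‖ ≤ ‖T.X m ω‖

/-- Cache-related coverage probability: the probability that the typical user requesting file `f` is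
served with an SINR larger than `τ`. -/
def coverage (f : ℕ) (τ : ℝ) : ℝ :=
  μ.real {ω | ∃ n, T.IsServing f n ω ∧ ENNReal.ofReal τ < T.sinr f n ω}

end MacroTier

end

/-! Fix the locations and let the server be at distance `r`. Its unit-mean exponential fading
exceeds `τ` times the normalized interference with conditional probability `exp (-interference)`,
and averaging over marks splits this into one factor per other station. That the server is nearest
is encoded by an infinite interference from every closer station that caches the file. Success
therefore has conditional probability `p` times the product of `retention α τ p r s` over the
distances `s` of the other stations; transmit power, intercept and antenna number have cancelled in
the ratio.

The Laplace functional of the Poisson process turns the product into `exp (-λ ∫ (1 - retention))`.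
Since `retention` depends only on `s / r`, the integral equals `π c r²` for a constant `c`. With `u
= r²` the candidate servers have intensity `λ π du`, so the coverage is `p λ π ∫ exp (-λ π c u) du =
p / c`, free of `λ`.

Integrating over the position of the server is the Campbell–Mecke step. Here it is a squeeze over
annuli `Q^j < ‖x‖² ≤ Q^(j+1)`: the points off an annulus are independent of the count in it
(`lintegral_mul_expNeg_tsum`), and `retention` decreases in `r`. Counting all points of the annulus,
with its inner radius as `r`, bounds success from above (`tsum_measure_successEvent_le`); requiring
a single point there, with the outer radius, bounds it from below (`le_measure_successEvent`). The
sums over `j` are Riemann sums of the exponential integral, and `Q → 1` gives `coverage_eq_div`.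

Polar coordinates identify `c` (`obstruction_eq`). The part over distances above one is the
continued hypergeometric function, whose series arises by expanding a Stieltjes integral; the part
over all distances is a product of two Gamma values. The case `τ = 0` follows by letting `τ`
decrease to zero. -/

noncomputable section

open Filter Topology

/-! ### The exponential `exp (-t)` for extended nonnegative `t` -/

/-- The function `t ↦ exp (-t)` on `[0, ∞]`. -/
def expNeg (t : ℝ≥0∞) : ℝ≥0∞ := (EReal.exp (t : EReal))⁻¹

theorem continuous_expNeg : Continuous expNeg :=
  continuous_inv.comp (ENNReal.continuous_exp.comp continuous_coe_ennreal_ereal)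

theorem measurable_expNeg : Measurable expNeg := continuous_expNeg.measurable

theorem antitone_expNeg : Antitone expNeg := fun a b h => by
  unfold expNeg
  exact ENNReal.inv_le_inv.2 (EReal.exp_monotone (by exact_mod_cast h))

@[simp] theorem expNeg_zero : expNeg 0 = 1 := by simp [expNeg]

@[simp] theorem expNeg_top : expNeg ⊤ = 0 := by simp [expNeg]

theorem expNeg_le_one (t : ℝ≥0∞) : expNeg t ≤ 1 := by
  simpa using antitone_expNeg (zero_le (a := t))

theorem expNeg_ne_top (t : ℝ≥0∞) : expNeg t ≠ ⊤ :=
  ((expNeg_le_one t).trans_lt ENNReal.one_lt_top).ne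

theorem expNeg_add (a b : ℝ≥0∞) : expNeg (a + b) = expNeg a * expNeg b := by
  unfold expNeg
  rw [EReal.coe_ennreal_add, EReal.exp_add, ENNReal.mul_inv]
  · exact Or.inl (by simp)
  · exact Or.inr (by simp)

theorem expNeg_ofReal {x : ℝ} (hx : 0 ≤ x) :
    expNeg (ENNReal.ofReal x) = ENNReal.ofReal (Real.exp (-x)) := by
  unfold expNeg
  rw [EReal.coe_ennreal_ofReal, max_eq_left hx, EReal.exp_coe, Real.exp_neg,
    ENNReal.ofReal_inv_of_pos (Real.exp_pos x)]

theorem expNeg_sum {ι : Type*} (s : Finset ι) (f : ι → ℝ≥0∞) :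
    expNeg (∑ i ∈ s, f i) = ∏ i ∈ s, expNeg (f i) := by
  classical
  induction s using Finset.induction_on with
  | empty => simp
  | insert a s ha ih => rw [Finset.sum_insert ha, Finset.prod_insert ha, expNeg_add, ih]

theorem expNeg_mul_natCast (c : ℝ≥0∞) (k : ℕ) : expNeg (c * k) = expNeg c ^ k := by
  induction k with
  | zero => simp
  | succ k ih => rw [Nat.cast_succ, mul_add, mul_one, expNeg_add, ih, pow_succ]

/-- The inverse of `expNeg` on `[0, 1]`. -/
def negLog (t : ℝ≥0∞) : ℝ≥0∞ := (ENNReal.log t⁻¹).toENNReal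

theorem expNeg_negLog {t : ℝ≥0∞} (ht : t ≤ 1) : expNeg (negLog t) = t := by
  unfold expNeg negLog
  rw [EReal.coe_toENNReal, ENNReal.exp_log, inv_inv]
  simpa using ht

theorem measurable_negLog : Measurable negLog :=
  (ENNReal.measurable_log.comp measurable_inv).ereal_toENNReal

theorem antitone_negLog : Antitone negLog := fun a b h => by
  unfold negLog
  exact EReal.toENNReal_le_toENNReal (ENNReal.log_monotone (ENNReal.inv_le_inv.2 h))

theorem tendsto_expNeg_sum_range (f : ℕ → ℝ≥0∞) :
    Tendsto (fun M => ∏ m ∈ Finset.range M, expNeg (f m)) atTop (𝓝 (expNeg (∑' m, f m))) := by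
  simp_rw [← expNeg_sum]
  exact (continuous_expNeg.tendsto _).comp ENNReal.summable.hasSum.tendsto_sum_nat

/-! ### Poisson counts: generating function and mean -/

section pointCount

variable {Ω : Type*} [MeasurableSpace Ω] {μ : Measure Ω} {X : ℕ → Ω → Plane} {lam : ℝ}

theorem measurable_pointCount (hX : ∀ n, Measurable (X n)) {A : Set Plane}
    (hA : MeasurableSet A) : Measurable (pointCount X A) := by
  unfold pointCount
  exact Measurable.tsum fun n => (measurable_const.indicator hA).comp (hX n)

namespace IsHomogeneousPoisson

/-- The mass function of the Poisson distribution of mean `lam * volume A`. -/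
def weight (lam : ℝ) (A : Set Plane) (k : ℕ) : ℝ :=
  Real.exp (-(lam * volume.real A)) * (lam * volume.real A) ^ k / (k.factorial : ℝ)

theorem weight_nonneg (hl : 0 ≤ lam) (A : Set Plane) (k : ℕ) : 0 ≤ weight lam A k := by
  unfold weight; positivity

/-- The probability generating function, summed by the exponential series. At `z = 1` it says that
the weights have total mass one. -/
theorem hasSum_weight_mul_pow (lam : ℝ) (A : Set Plane) (z : ℝ) :
    HasSum (fun k => weight lam A k * z ^ k) (Real.exp (-(lam * volume.real A * (1 - z)))) := by
  have h := (NormedSpace.expSeries_div_hasSum_exp (lam * volume.real A * z)).mul_left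
    (Real.exp (-(lam * volume.real A)))
  rw [← Real.exp_eq_exp_ℝ, ← Real.exp_add] at h
  convert! h using 1
  · ext k; unfold weight; rw [mul_pow]; ring
  · ring_nf

/-- The term at `k + 1` is the mean times the weight at `k`, so the sum reduces to the total mass.
-/
theorem hasSum_weight_mul_id (lam : ℝ) (A : Set Plane) :
    HasSum (fun k : ℕ => weight lam A k * k) (lam * volume.real A) := by
  rw [← hasSum_nat_add_iff' 1]
  have h := (hasSum_weight_mul_pow lam A 1).mul_left (lam * volume.real A)
  simp only [one_pow, mul_one, sub_self, mul_zero, neg_zero, Real.exp_zero] at h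
  convert! h using 1
  · ext k
    unfold weight
    rw [Nat.factorial_succ]
    push_cast
    have : (k.factorial : ℝ) ≠ 0 := by positivity
    have : (k : ℝ) + 1 ≠ 0 := by positivity
    field_simp
    ring
  · simp

theorem measure_pointCount_eq [IsProbabilityMeasure μ] (h : IsHomogeneousPoisson μ X lam)
    {A : Set Plane} (hA : MeasurableSet A) (hv : volume A ≠ ∞) (k : ℕ) :
    μ {ω | pointCount X A ω = k} = ENNReal.ofReal (weight lam A k) := by
  rw [weight, ← h.poisson A hA hv k, ofReal_measureReal]

/-- The Poisson weights already add up to one, which leaves no mass for an infinite count. -/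
theorem ae_exists_natCast [IsProbabilityMeasure μ] (h : IsHomogeneousPoisson μ X lam)
    (hl : 0 ≤ lam) {A : Set Plane} (hA : MeasurableSet A) (hv : volume A ≠ ∞) :
    ∀ᵐ ω ∂μ, ∃ k : ℕ, pointCount X A ω = k := by
  have hm : ∀ k : ℕ, MeasurableSet {ω | pointCount X A ω = k} := fun k =>
    measurableSet_eq_fun (measurable_pointCount h.measurable hA) measurable_const
  have hU : {ω | ∃ k : ℕ, pointCount X A ω = k} = ⋃ k : ℕ, {ω | pointCount X A ω = k} := by
    ext; simp
  have hmU : MeasurableSet {ω | ∃ k : ℕ, pointCount X A ω = k} := by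
    rw [hU]; exact MeasurableSet.iUnion hm
  have key : μ {ω | ∃ k : ℕ, pointCount X A ω = k} = 1 := by
    rw [hU, measure_iUnion _ hm]
    · simp_rw [h.measure_pointCount_eq hA hv]
      have hs := hasSum_weight_mul_pow lam A 1
      simp only [one_pow, mul_one, sub_self, mul_zero, neg_zero, Real.exp_zero] at hs
      rw [← ENNReal.ofReal_tsum_of_nonneg (weight_nonneg hl A) hs.summable, hs.tsum_eq,
        ENNReal.ofReal_one]
    · intro i j hij
      refine Set.disjoint_left.2 fun ω hi hj => hij ?_
      have : (i : ℝ≥0∞) = j := hi.symm.trans hj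
      exact_mod_cast this
  exact (prob_compl_eq_zero_iff hmU).2 key

theorem lintegral_comp_pointCount [IsProbabilityMeasure μ] (h : IsHomogeneousPoisson μ X lam)
    (hl : 0 ≤ lam) {A : Set Plane} (hA : MeasurableSet A) (hv : volume A ≠ ∞)
    (F : ℝ≥0∞ → ℝ≥0∞) :
    ∫⁻ ω, F (pointCount X A ω) ∂μ = ∑' k : ℕ, ENNReal.ofReal (weight lam A k) * F k := by
  have hm : ∀ k : ℕ, MeasurableSet {ω | pointCount X A ω = k} := fun k =>
    measurableSet_eq_fun (measurable_pointCount h.measurable hA) measurable_const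
  have e : (fun ω => F (pointCount X A ω)) =ᵐ[μ]
      fun ω => ∑' k : ℕ, {ω | pointCount X A ω = k}.indicator (fun _ => F k) ω := by
    filter_upwards [h.ae_exists_natCast hl hA hv] with ω hω
    obtain ⟨k, hk⟩ := hω
    rw [tsum_eq_single k]
    · simp [hk]
    · intro j hj
      rw [Set.indicator_of_notMem]
      intro hj'
      have : (k : ℝ≥0∞) = j := hk.symm.trans hj'
      exact hj (by exact_mod_cast this.symm)
  rw [lintegral_congr_ae e, lintegral_tsum fun k => (measurable_const.indicator (hm k)).aemeasurable]
  refine tsum_congr fun k => ?_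
  rw [lintegral_indicator_const (hm k), h.measure_pointCount_eq hA hv, mul_comm]

theorem lintegral_pointCount [IsProbabilityMeasure μ] (h : IsHomogeneousPoisson μ X lam)
    (hl : 0 ≤ lam) {A : Set Plane} (hA : MeasurableSet A) (hv : volume A ≠ ∞) :
    ∫⁻ ω, pointCount X A ω ∂μ = ENNReal.ofReal lam * volume A := by
  have hs := hasSum_weight_mul_id lam A
  rw [h.lintegral_comp_pointCount hl hA hv (fun t => t)]
  have : ∀ k : ℕ, ENNReal.ofReal (weight lam A k) * (k : ℝ≥0∞)
      = ENNReal.ofReal (weight lam A k * k) := fun k => by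
    rw [ENNReal.ofReal_mul (weight_nonneg hl A k), ENNReal.ofReal_natCast]
  simp_rw [this]
  rw [← ENNReal.ofReal_tsum_of_nonneg
    (fun k => mul_nonneg (weight_nonneg hl A k) (Nat.cast_nonneg k)) hs.summable, hs.tsum_eq,
    ENNReal.ofReal_mul hl, ofReal_measureReal]

/-- The generating function at `z = exp (-c)`. The value `c = ⊤` is allowed and gives the void
probability. -/
theorem lintegral_expNeg_mul_pointCount [IsProbabilityMeasure μ]
    (h : IsHomogeneousPoisson μ X lam) (hl : 0 ≤ lam) {A : Set Plane} (hA : MeasurableSet A)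
    (hv : volume A ≠ ∞) (c : ℝ≥0∞) :
    ∫⁻ ω, expNeg (c * pointCount X A ω) ∂μ
      = expNeg (ENNReal.ofReal lam * ((1 - expNeg c) * volume A)) := by
  set z := (expNeg c).toReal with hz
  have hzc : expNeg c = ENNReal.ofReal z := (ENNReal.ofReal_toReal (expNeg_ne_top c)).symm
  have hz0 : 0 ≤ z := ENNReal.toReal_nonneg
  have hz1 : z ≤ 1 := by
    have := expNeg_le_one c
    rw [hzc] at this
    simpa using this
  have hs := hasSum_weight_mul_pow lam A z
  rw [h.lintegral_comp_pointCount hl hA hv (fun t => expNeg (c * t))]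
  have : ∀ k : ℕ, ENNReal.ofReal (weight lam A k) * expNeg (c * k)
      = ENNReal.ofReal (weight lam A k * z ^ k) := fun k => by
    rw [expNeg_mul_natCast, hzc, ENNReal.ofReal_mul (weight_nonneg hl A k), ENNReal.ofReal_pow hz0]
  simp_rw [this]
  rw [← ENNReal.ofReal_tsum_of_nonneg
    (fun k => mul_nonneg (weight_nonneg hl A k) (pow_nonneg hz0 k)) hs.summable, hs.tsum_eq,
    ← expNeg_ofReal (by have := sub_nonneg.2 hz1; positivity)]
  congr 1
  rw [hzc, ← ENNReal.ofReal_one, ← ENNReal.ofReal_sub _ hz0, ← ofReal_measureReal hv,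
    ← ENNReal.ofReal_mul (sub_nonneg.2 hz1), ← ENNReal.ofReal_mul hl]
  congr 1
  ring

end IsHomogeneousPoisson
end pointCount

/-! ### The Laplace functional of the Poisson process -/

section Laplace

variable {Ω : Type*} [MeasurableSpace Ω] {μ : Measure Ω} {X : ℕ → Ω → Plane} {lam : ℝ}

namespace IsHomogeneousPoisson

/-- Counts in disjoint sets are independent, so the expectation factorises. The set of index zero
carries the arbitrary function `F`; the others carry exponentials. -/
theorem lintegral_mul_expNeg_sum [IsProbabilityMeasure μ] (h : IsHomogeneousPoisson μ X lam)
    (hl : 0 ≤ lam) {m : ℕ} {A : Fin (m + 1) → Set Plane} (hA : ∀ i, MeasurableSet (A i))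
    (hd : Pairwise fun i j => Disjoint (A i) (A j)) (hv : ∀ i, volume (A i) ≠ ∞)
    {F : ℝ≥0∞ → ℝ≥0∞} (hF : Measurable F) (c : Fin m → ℝ≥0∞) :
    ∫⁻ ω, F (pointCount X (A 0) ω) * expNeg (∑ i, c i * pointCount X (A i.succ) ω) ∂μ
      = (∫⁻ ω, F (pointCount X (A 0) ω) ∂μ)
        * expNeg (ENNReal.ofReal lam * ∑ i, (1 - expNeg (c i)) * volume (A i.succ)) := by
  let Φ : Fin (m + 1) → ℝ≥0∞ → ℝ≥0∞ := Fin.cons F fun i t => expNeg (c i * t)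
  have hΦ : ∀ i, Measurable (Φ i) := by
    intro i
    refine Fin.cases ?_ (fun i => ?_) i
    · simpa [Φ] using hF
    · exact measurable_expNeg.comp (measurable_id.const_mul (c i))
  have hi := (h.indep (m + 1) A hA hd).comp Φ hΦ
  have key := lintegral_prod_eq_prod_lintegral_of_indepFun Finset.univ _ hi
    (fun i => (hΦ i).comp (measurable_pointCount h.measurable (hA i)))
  simp only [Fin.prod_univ_succ, Function.comp_apply, Φ, Fin.cons_zero, Fin.cons_succ] at key
  simp_rw [expNeg_sum]
  rw [key]
  congr 1
  rw [Finset.mul_sum, expNeg_sum]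
  exact Finset.prod_congr rfl fun i _ =>
    h.lintegral_expNeg_mul_pointCount hl (hA i.succ) (hv i.succ) (c i)

theorem lintegral_mul_expNeg_tsum_simpleFunc [IsProbabilityMeasure μ]
    (h : IsHomogeneousPoisson μ X lam) (hl : 0 ≤ lam) {A : Set Plane} (hA : MeasurableSet A)
    (hv : volume A ≠ ∞) {F : ℝ≥0∞ → ℝ≥0∞} (hF : Measurable F) (s : SimpleFunc Plane ℝ≥0∞)
    (hs : ∀ x ∈ A, s x = 0) (hsv : volume (Function.support s) ≠ ∞) :
    ∫⁻ ω, F (pointCount X A ω) * expNeg (∑' n, s (X n ω)) ∂μ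
      = (∫⁻ ω, F (pointCount X A ω) ∂μ)
        * expNeg (ENNReal.ofReal lam * ∫⁻ x, (1 - expNeg (s x))) := by
  classical
  -- Only nonzero values are kept: their level sets have finite volume and miss `A`, where `s`
  -- vanishes.
  set R := s.range.filter (· ≠ 0) with hR
  let e := R.equivFin.symm
  let B : Fin (R.card + 1) → Set Plane := Fin.cons A fun i => s ⁻¹' {(e i : ℝ≥0∞)}
  have B0 : B 0 = A := rfl
  have Bs : ∀ i : Fin R.card, B i.succ = s ⁻¹' {(e i : ℝ≥0∞)} := fun i => rfl
  have he0 : ∀ i, (e i : ℝ≥0∞) ≠ 0 := fun i => (Finset.mem_filter.1 (e i).2).2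
  have hB : ∀ i, MeasurableSet (B i) := by
    intro i
    refine Fin.cases ?_ (fun i => ?_) i
    · simpa [B0] using hA
    · rw [Bs]; exact s.measurableSet_fiber _
  have hBv : ∀ i, volume (B i) ≠ ∞ := by
    intro i
    refine Fin.cases ?_ (fun i => ?_) i
    · simpa [B0] using hv
    · rw [Bs]
      refine measure_ne_top_of_subset (fun x hx => ?_) hsv
      have hx' : s x = e i := hx
      rw [Function.mem_support, hx']
      exact he0 i
  have hA0 : ∀ i : Fin R.card, Disjoint A (s ⁻¹' {(e i : ℝ≥0∞)}) := fun i =>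
    Set.disjoint_left.2 fun x hx hx' => he0 i (by
      have : s x = e i := hx'
      rw [← this, hs x hx])
  have hd : Pairwise fun i j => Disjoint (B i) (B j) := by
    intro i j
    refine Fin.cases ?_ (fun i => ?_) i <;> refine Fin.cases ?_ (fun j => ?_) j
    · intro hij; exact absurd rfl hij
    · intro _; exact hA0 j
    · intro _; exact (hA0 i).symm
    · intro hij
      refine Set.disjoint_left.2 fun x hx hx' => hij ?_
      have h1 : s x = e i := hx
      have h2 : s x = e j := hx'
      have : e i = e j := Subtype.ext (h1.symm.trans h2)
      rw [e.injective this]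
  have key := h.lintegral_mul_expNeg_sum hl hB hd hBv hF fun i => (e i : ℝ≥0∞)
  have dec : ∀ (Ψ : ℝ≥0∞ → ℝ≥0∞) (_ : Ψ 0 = 0) (x : Plane),
      Ψ (s x) = ∑ i, Ψ (e i) * (s ⁻¹' {(e i : ℝ≥0∞)}).indicator (fun _ => 1) x := by
    intro Ψ hΨ x
    by_cases hx : s x = 0
    · rw [hx, hΨ]
      refine (Finset.sum_eq_zero fun i _ => ?_).symm
      rw [Set.indicator_of_notMem, mul_zero]
      intro hx'
      have h1 : s x = e i := hx'
      exact he0 i (h1.symm.trans hx)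
    · have hmem : s x ∈ R := Finset.mem_filter.2 ⟨s.mem_range_self x, hx⟩
      rw [Finset.sum_eq_single (e.symm ⟨s x, hmem⟩)]
      · simp
      · intro j _ hj
        rw [Set.indicator_of_notMem, mul_zero]
        intro hx'
        have h1 : s x = e j := hx'
        refine hj ?_
        rw [Equiv.eq_symm_apply]
        exact Subtype.ext h1.symm
      · intro hh; exact absurd (Finset.mem_univ _) hh
  simp only [B0, Bs] at key
  have e1 : ∀ ω, ∑' n, s (X n ω)
      = ∑ i, (e i : ℝ≥0∞) * pointCount X (s ⁻¹' {(e i : ℝ≥0∞)}) ω := by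
    intro ω
    simp_rw [pointCount, ← ENNReal.tsum_mul_left]
    rw [← Summable.tsum_finsetSum fun i _ => ENNReal.summable]
    exact tsum_congr fun n => dec id rfl (X n ω)
  have e2 : ∫⁻ x, (1 - expNeg (s x))
      = ∑ i, (1 - expNeg (e i)) * volume (s ⁻¹' {(e i : ℝ≥0∞)}) := by
    simp_rw [dec (fun t => 1 - expNeg t) (by simp)]
    rw [lintegral_finsetSum]
    · refine Finset.sum_congr rfl fun i _ => ?_
      rw [lintegral_const_mul _ (measurable_const.indicator (s.measurableSet_fiber _)),
        lintegral_indicator_const (s.measurableSet_fiber _), one_mul]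
    · exact fun i _ => (measurable_const.indicator (s.measurableSet_fiber _)).const_mul _
  simp_rw [e1, e2]
  exact key

/-- The Laplace functional of a Poisson process off a set `A`, jointly with the number of points
in `A`. -/
theorem lintegral_mul_expNeg_tsum [IsProbabilityMeasure μ]
    (h : IsHomogeneousPoisson μ X lam) (hl : 0 ≤ lam) {A : Set Plane} (hA : MeasurableSet A)
    (hv : volume A ≠ ∞) {F : ℝ≥0∞ → ℝ≥0∞} (hF : Measurable F)
    (hFi : ∫⁻ ω, F (pointCount X A ω) ∂μ ≠ ∞) {φ : Plane → ℝ≥0∞} (hφ : Measurable φ)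
    (hφA : ∀ x ∈ A, φ x = 0) :
    ∫⁻ ω, F (pointCount X A ω) * expNeg (∑' n, φ (X n ω)) ∂μ
      = (∫⁻ ω, F (pointCount X A ω) ∂μ)
        * expNeg (ENNReal.ofReal lam * ∫⁻ x, (1 - expNeg (φ x))) := by
  -- Cutting off to balls gives supports of finite volume and keeps the approximation increasing to
  -- `φ`.
  let s : ℕ → SimpleFunc Plane ℝ≥0∞ := fun k =>
    (SimpleFunc.eapprox φ k).restrict (Metric.ball 0 k)
  have hsx : ∀ k x, s k x = (Metric.ball (0 : Plane) k).indicator (SimpleFunc.eapprox φ k) x :=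
    fun k x => SimpleFunc.restrict_apply _ Metric.isOpen_ball.measurableSet x
  have hmono : ∀ x, Monotone fun k => s k x := by
    intro x j k hjk
    simp only [hsx]
    refine (Set.indicator_le_indicator_of_subset (Metric.ball_subset_ball (by exact_mod_cast hjk))
      (fun _ => zero_le) x).trans (Set.indicator_le_indicator ?_)
    exact SimpleFunc.monotone_eapprox φ hjk x
  have hlim : ∀ x, Tendsto (fun k => s k x) atTop (𝓝 (φ x)) := by
    intro x
    have h1 : Tendsto (fun k => SimpleFunc.eapprox φ k x) atTop (𝓝 (φ x)) :=
      SimpleFunc.tendsto_eapprox hφ x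
    refine h1.congr' ?_
    filter_upwards [eventually_gt_atTop (Nat.ceil ‖x‖)] with k hk
    rw [hsx, Set.indicator_of_mem]
    rw [mem_ball_zero_iff]
    exact (Nat.le_ceil _).trans_lt (by exact_mod_cast hk)
  have hle : ∀ k x, s k x ≤ φ x := fun k x => (hmono x).ge_of_tendsto (hlim x) k
  have hsupp : ∀ k, Function.support (s k) ⊆ Metric.ball (0 : Plane) k := by
    intro k x hx
    by_contra hx'
    exact hx (by rw [hsx, Set.indicator_of_notMem hx'])
  have hk := fun k => h.lintegral_mul_expNeg_tsum_simpleFunc hl hA hv hF (s k)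
    (fun x hx => le_antisymm ((hle k x).trans (hφA x hx).le) zero_le)
    (measure_ne_top_of_subset (hsupp k) measure_ball_lt_top.ne)
  -- Monotone convergence for the counting measure on the indices.
  have hsum : ∀ ω, Tendsto (fun k => ∑' n, s k (X n ω)) atTop (𝓝 (∑' n, φ (X n ω))) := by
    intro ω
    have := lintegral_tendsto_of_tendsto_of_monotone (μ := Measure.count)
      (f := fun k n => s k (X n ω)) (F := fun n => φ (X n ω))
      (fun k => measurable_from_nat.aemeasurable)
      (ae_of_all _ fun n => hmono (X n ω)) (ae_of_all _ fun n => hlim (X n ω))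
    simpa only [lintegral_count] using this
  have hmC : Measurable (pointCount X A) := measurable_pointCount h.measurable hA
  have L1 : Tendsto (fun k => ∫⁻ ω, F (pointCount X A ω) * expNeg (∑' n, s k (X n ω)) ∂μ) atTop
      (𝓝 (∫⁻ ω, F (pointCount X A ω) * expNeg (∑' n, φ (X n ω)) ∂μ)) := by
    refine tendsto_lintegral_of_dominated_convergence' (fun ω => F (pointCount X A ω)) ?_ ?_ hFi ?_
    · intro k
      exact ((hF.comp hmC).mul (measurable_expNeg.comp
        (Measurable.tsum fun n => (s k).measurable.comp (h.measurable n)))).aemeasurable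
    · exact fun k => ae_of_all _ fun ω => mul_le_of_le_one_right zero_le (expNeg_le_one _)
    · have hfin := ae_lt_top (hF.comp hmC) hFi
      filter_upwards [hfin] with ω hω
      exact ENNReal.Tendsto.const_mul ((continuous_expNeg.tendsto _).comp (hsum ω)) (Or.inr hω.ne)
  have L2 : Tendsto (fun k => ∫⁻ x, (1 - expNeg (s k x))) atTop
      (𝓝 (∫⁻ x, (1 - expNeg (φ x)))) := by
    refine lintegral_tendsto_of_tendsto_of_monotone ?_ ?_ ?_
    · exact fun k => (measurable_const.sub (measurable_expNeg.comp (s k).measurable)).aemeasurable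
    · exact ae_of_all _ fun x j k hjk => tsub_le_tsub_left (antitone_expNeg (hmono x hjk)) _
    · refine ae_of_all _ fun x => ?_
      exact ENNReal.Tendsto.sub tendsto_const_nhds ((continuous_expNeg.tendsto _).comp (hlim x))
        (Or.inl ENNReal.one_ne_top)
  have L3 := ENNReal.Tendsto.const_mul ((continuous_expNeg.tendsto _).comp
    (ENNReal.Tendsto.const_mul L2 (Or.inr (ENNReal.ofReal_ne_top (r := lam))))) (Or.inr hFi)
  exact tendsto_nhds_unique L1 (L3.congr fun k => (hk k).symm)

end IsHomogeneousPoisson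
end Laplace

/-! ### Exponential fading and independent marks -/

section Marks

theorem expMeasure_one_Ioi {x : ℝ} (hx : 0 ≤ x) :
    expMeasure 1 (Set.Ioi x) = ENNReal.ofReal (Real.exp (-x)) := by
  have := isProbabilityMeasure_expMeasure (r := 1) one_pos
  rw [← Set.compl_Iic, prob_compl_eq_one_sub measurableSet_Iic, ← ofReal_cdf,
    cdf_expMeasure_eq one_pos, if_pos hx, ← ENNReal.ofReal_one, ← ENNReal.ofReal_sub]
  · congr 1; simp
  · simpa using hx

theorem lintegral_expNeg_expMeasure_one {s : ℝ} (hs : 0 ≤ s) :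
    ∫⁻ x, expNeg (ENNReal.ofReal s * ENNReal.ofReal x) ∂(expMeasure 1)
      = ENNReal.ofReal (1 + s)⁻¹ := by
  have hd : expMeasure 1 = volume.withDensity (exponentialPDF 1) := rfl
  have hm : Measurable (exponentialPDF 1) := (measurable_exponentialPDFReal 1).ennreal_ofReal
  have hm2 : Measurable fun x : ℝ => expNeg (ENNReal.ofReal s * ENNReal.ofReal x) :=
    measurable_expNeg.comp (ENNReal.measurable_ofReal.const_mul _)
  rw [hd, lintegral_withDensity_eq_lintegral_mul _ hm hm2]
  have e : ∫⁻ x, (exponentialPDF 1 * fun x => expNeg (ENNReal.ofReal s * ENNReal.ofReal x)) x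
      = ∫⁻ x in Set.Ioi 0, ENNReal.ofReal (Real.exp (-(1 + s) * x)) := by
    rw [← setLIntegral_congr (Ioi_ae_eq_Ici (a := (0 : ℝ))).symm,
      ← lintegral_indicator measurableSet_Ici]
    refine lintegral_congr fun x => ?_
    rw [Pi.mul_apply]
    by_cases hx : 0 ≤ x
    · rw [Set.indicator_of_mem (Set.mem_Ici.2 hx), exponentialPDF_of_nonneg hx,
        ← ENNReal.ofReal_mul hs, expNeg_ofReal (mul_nonneg hs hx), ← ENNReal.ofReal_mul
          (by positivity)]
      congr 1
      rw [one_mul, one_mul, ← Real.exp_add]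
      ring_nf
    · rw [Set.indicator_of_notMem (by simpa using hx), exponentialPDF_of_neg (not_le.1 hx), zero_mul]
  rw [e, ← ofReal_integral_eq_lintegral_ofReal
    (integrableOn_exp_mul_Ioi (by linarith) 0) (ae_of_all _ fun x => (Real.exp_pos _).le),
    integral_exp_mul_Ioi (by linarith)]
  congr 1
  have : (1 : ℝ) + s ≠ 0 := by positivity
  rw [mul_zero, Real.exp_zero, neg_div_neg_eq, one_div]

variable {Ω : Type*} [MeasurableSpace Ω] {μ : Measure Ω}

/-- The exponential tail, stated on `[0, ∞]` so that an infinite interference is never beaten. -/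
theorem measure_lt_ofReal_of_map_eq_expMeasure {H : Ω → ℝ} (hH : Measurable H)
    (hm : μ.map H = expMeasure 1) (t : ℝ≥0∞) :
    μ {ω | t < ENNReal.ofReal (H ω)} = expNeg t := by
  induction t with
  | top => simp
  | coe t =>
    have : {ω | (t : ℝ≥0∞) < ENNReal.ofReal (H ω)} = H ⁻¹' Set.Ioi (t : ℝ) := by
      ext ω
      simp only [Set.mem_ofPred_eq, Set.mem_preimage, Set.mem_Ioi]
      rw [← ENNReal.ofReal_coe_nnreal, ENNReal.ofReal_lt_ofReal_iff']
      exact ⟨fun h => h.1, fun h => ⟨h, t.2.trans_lt h⟩⟩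
    rw [this, ← Measure.map_apply hH measurableSet_Ioi, hm, expMeasure_one_Ioi t.coe_nonneg,
      ← ENNReal.ofReal_coe_nnreal, expNeg_ofReal t.coe_nonneg]

theorem lintegral_expNeg_of_map_eq_expMeasure {H : Ω → ℝ} (hH : Measurable H)
    (hm : μ.map H = expMeasure 1) {s : ℝ} (hs : 0 ≤ s) :
    ∫⁻ ω, expNeg (ENNReal.ofReal s * ENNReal.ofReal (H ω)) ∂μ = ENNReal.ofReal (1 + s)⁻¹ := by
  rw [← lintegral_expNeg_expMeasure_one hs, ← hm, lintegral_map _ hH]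
  exact measurable_expNeg.comp (ENNReal.measurable_ofReal.const_mul _)

variable {β : Type*} [MeasurableSpace β]

/-- Independence from a whole process is tested on finitely many coordinates; there the `n`-th
coordinate is constant and the rest are functions of the other `U m`. -/
theorem ProbabilityTheory.iIndepFun.indepFun_apply_off [IsProbabilityMeasure μ] {U : ℕ → Ω → β}
    (hU : ∀ m, Measurable (U m)) (hi : iIndepFun U μ) (n : ℕ) {y : ℕ → β → ℝ≥0∞}
    (hy : ∀ m, Measurable (y m)) :
    IndepFun (U n) (fun ω m => if m = n then 0 else y m (U m ω)) μ := by
  refine IndepFun.indepFun_process (hU n) (fun m => ?_) fun I => ?_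
  · by_cases h : m = n
    · simp [h]
    · simp only [h, if_false]; exact (hy m).comp (hU m)
  · have h := hi.indepFun_finset {n} (I.erase n) (by simp) hU
    have hn : n ∈ ({n} : Finset ℕ) := by simp
    let g : ((i : I.erase n) → β) → (i : I) → ℝ≥0∞ := fun u i =>
      if h : (i : ℕ) = n then 0 else y i (u ⟨i, Finset.mem_erase.2 ⟨h, i.2⟩⟩)
    have hg : Measurable g := by
      refine measurable_pi_lambda _ fun i => ?_
      by_cases h : (i : ℕ) = n
      · simp [g, h]
      · simp only [g, h, dif_neg, not_false_eq_true]; exact (hy i).comp (measurable_pi_apply _)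
    exact h.comp (φ := fun u : ({n} : Finset ℕ) → β => u ⟨n, hn⟩) (ψ := g)
      (measurable_pi_apply (⟨n, hn⟩ : ({n} : Finset ℕ))) hg

theorem lintegral_expNeg_tsum_of_iIndepFun [IsProbabilityMeasure μ] {Y : ℕ → Ω → ℝ≥0∞}
    (hY : ∀ m, Measurable (Y m)) (hi : iIndepFun Y μ) {ψ : ℕ → ℝ≥0∞}
    (hψ : ∀ m, ∫⁻ ω, expNeg (Y m ω) ∂μ = expNeg (ψ m)) :
    ∫⁻ ω, expNeg (∑' m, Y m ω) ∂μ = expNeg (∑' m, ψ m) := by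
  have h1 : Tendsto (fun M => ∫⁻ ω, ∏ m ∈ Finset.range M, expNeg (Y m ω) ∂μ) atTop
      (𝓝 (∫⁻ ω, expNeg (∑' m, Y m ω) ∂μ)) := by
    refine tendsto_lintegral_of_dominated_convergence (fun _ => 1) (fun M => ?_) (fun M => ?_)
      (by simp) ?_
    · exact Finset.measurable_prod _ fun m _ => measurable_expNeg.comp (hY m)
    · exact ae_of_all _ fun ω => Finset.prod_le_one' fun m _ => expNeg_le_one _
    · exact ae_of_all _ fun ω => tendsto_expNeg_sum_range _
  have h2 : ∀ M, ∫⁻ ω, ∏ m ∈ Finset.range M, expNeg (Y m ω) ∂μ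
      = ∏ m ∈ Finset.range M, expNeg (ψ m) := by
    intro M
    have := lintegral_prod_eq_prod_lintegral_of_indepFun (Finset.range M)
      (fun m ω => expNeg (Y m ω)) (hi.comp (fun _ => expNeg) fun _ => measurable_expNeg)
      (fun m => measurable_expNeg.comp (hY m))
    rw [this]
    exact Finset.prod_congr rfl fun m _ => hψ m
  simp_rw [h2] at h1
  exact tendsto_nhds_unique h1 (tendsto_expNeg_sum_range ψ)

/-- If `V` has tail `q exp (-t)` and `Z` is independent of it, Fubini gives `P(Z < V) = q E[exp
(-Z)]`. For a sum `Z` of independent terms, the last expectation is a product. -/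
theorem measure_tsum_lt_of_iIndepFun [IsProbabilityMeasure μ] {U : ℕ → Ω → β}
    (hU : ∀ m, Measurable (U m)) (hi : iIndepFun U μ) (n : ℕ) {y : ℕ → β → ℝ≥0∞}
    (hy : ∀ m, Measurable (y m)) {v : β → ℝ≥0∞} (hv : Measurable v) {q : ℝ≥0∞}
    (hq : ∀ t, μ {ω | t < v (U n ω)} = q * expNeg t) {ψ : ℕ → ℝ≥0∞}
    (hψ : ∀ m, m ≠ n → ∫⁻ ω, expNeg (y m (U m ω)) ∂μ = expNeg (ψ m)) :
    μ {ω | ∑' m, (if m = n then 0 else y m (U m ω)) < v (U n ω)}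
      = q * expNeg (∑' m, if m = n then 0 else ψ m) := by
  set Y : ℕ → Ω → ℝ≥0∞ := fun m ω => if m = n then 0 else y m (U m ω) with hYd
  have hY : ∀ m, Measurable (Y m) := fun m => by
    by_cases h : m = n
    · simp [hYd, h]
    · simp only [hYd, h, if_false]; exact (hy m).comp (hU m)
  have hYi : iIndepFun Y μ := by
    have := hi.comp (fun m b => if m = n then 0 else y m b) fun m => by
      by_cases h : m = n
      · simp [h]
      · simpa [h] using hy m
    exact this
  have hL := lintegral_expNeg_tsum_of_iIndepFun hY hYi (ψ := fun m => if m = n then 0 else ψ m)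
    fun m => by
      by_cases h : m = n
      · simp [hYd, h]
      · simpa [hYd, h] using hψ m h
  rw [← hL]
  have hZm : Measurable fun ω => ∑' m, Y m ω := Measurable.tsum hY
  have hind : IndepFun (fun ω => ∑' m, Y m ω) (fun ω => v (U n ω)) μ :=
    ((hi.indepFun_apply_off hU n hy).comp (φ := v) (ψ := fun z : ℕ → ℝ≥0∞ => ∑' m, z m) hv
      (Measurable.tsum fun m => measurable_pi_apply m)).symm
  have hVm : Measurable fun ω => v (U n ω) := hv.comp (hU n)
  have hmap := (indepFun_iff_map_prod_eq_prod_map_map hZm.aemeasurable hVm.aemeasurable).1 hind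
  have hS : MeasurableSet {z : ℝ≥0∞ × ℝ≥0∞ | z.1 < z.2} :=
    measurableSet_lt measurable_fst measurable_snd
  have e : {ω | ∑' m, Y m ω < v (U n ω)}
      = (fun ω => (∑' m, Y m ω, v (U n ω))) ⁻¹' {z : ℝ≥0∞ × ℝ≥0∞ | z.1 < z.2} := rfl
  have := Measure.isProbabilityMeasure_map (μ := μ) hVm.aemeasurable
  rw [e, ← Measure.map_apply (hZm.prodMk hVm) hS, hmap, Measure.prod_apply hS,
    lintegral_map (measurable_measure_prodMk_left hS) hZm,
    ← lintegral_const_mul q (f := fun ω => expNeg (∑' m, Y m ω)) (measurable_expNeg.comp hZm)]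
  refine lintegral_congr fun ω => ?_
  rw [Measure.map_apply hVm (measurable_prodMk_left hS)]
  exact hq _

/-- Fubini in the form of freezing the first variable; it is used to fix the locations and average
over the marks. -/
theorem measure_preimage_prodMk_of_indepFun [IsProbabilityMeasure μ] {γ : Type*}
    [MeasurableSpace γ] {X : Ω → γ} {U : Ω → β} (hX : Measurable X) (hU : Measurable U)
    (hi : IndepFun X U μ) {D : Set (γ × β)} (hD : MeasurableSet D) :
    μ {ω | (X ω, U ω) ∈ D} = ∫⁻ ω, μ {ω' | (X ω, U ω') ∈ D} ∂μ := by
  have hmap := (indepFun_iff_map_prod_eq_prod_map_map hX.aemeasurable hU.aemeasurable).1 hi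
  have e : {ω | (X ω, U ω) ∈ D} = (fun ω => (X ω, U ω)) ⁻¹' D := rfl
  have := Measure.isProbabilityMeasure_map (μ := μ) hU.aemeasurable
  rw [e, ← Measure.map_apply (hX.prodMk hU) hD, hmap, Measure.prod_apply hD,
    lintegral_map (measurable_measure_prodMk_left hD) hX]
  refine lintegral_congr fun ω => ?_
  rw [Measure.map_apply hU (measurable_prodMk_left hD)]
  rfl

/-- Two mutually independent sequences, each of independent variables, pair up to a sequence of
independent variables. -/
theorem iIndepFun_prodMk_of_indepFun [IsProbabilityMeasure μ] {γ : Type*} [MeasurableSpace γ]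
    {U : ℕ → Ω → β} {W : ℕ → Ω → γ} (hU : ∀ m, Measurable (U m)) (hW : ∀ m, Measurable (W m))
    (hUi : iIndepFun U μ) (hWi : iIndepFun W μ)
    (hi : IndepFun (fun ω m => U m ω) (fun ω m => W m ω) μ) :
    iIndepFun (fun m ω => (U m ω, W m ω)) μ := by
  -- Measurable rectangles form a π-system generating the sigma-algebra of each pair, and on them
  -- the product formula follows from the three independence hypotheses.
  let π : ℕ → Set (Set Ω) := fun m => {s | ∃ a b, MeasurableSet a ∧ MeasurableSet b ∧
    s = U m ⁻¹' a ∩ W m ⁻¹' b}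
  refine iIndepSets.iIndep (π := π) (fun m => ((hU m).prodMk (hW m)).comap_le) ?_ ?_ ?_
  · rintro m _ ⟨a, b, ha, hb, rfl⟩ _ ⟨a', b', ha', hb', rfl⟩ _
    exact ⟨a ∩ a', b ∩ b', ha.inter ha', hb.inter hb', by ext; simp; tauto⟩
  · intro m
    rw [← generateFrom_prod, MeasurableSpace.comap_generateFrom]
    congr 1
    ext s
    constructor
    · rintro ⟨_, ⟨a, ha, b, hb, rfl⟩, rfl⟩
      exact ⟨a, b, ha, hb, rfl⟩
    · rintro ⟨a, b, ha, hb, rfl⟩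
      exact ⟨a ×ˢ b, ⟨a, ha, b, hb, rfl⟩, rfl⟩
  · rw [iIndepSets_iff]
    intro s f hf
    choose! a b ha hb hab using hf
    have hI : ⋂ i ∈ s, f i = (⋂ i ∈ s, U i ⁻¹' a i) ∩ ⋂ i ∈ s, W i ⁻¹' b i := by
      rw [Set.iInter₂_congr hab]
      ext ω
      simp only [Set.mem_iInter, Set.mem_inter_iff]
      exact ⟨fun h => ⟨fun i hi => (h i hi).1, fun i hi => (h i hi).2⟩,
        fun h i hi => ⟨h.1 i hi, h.2 i hi⟩⟩
    have h1 : ∀ m ∈ s, μ (U m ⁻¹' a m ∩ W m ⁻¹' b m)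
        = μ (U m ⁻¹' a m) * μ (W m ⁻¹' b m) := fun m hm =>
      (hi.comp (φ := fun u : ℕ → β => u m) (ψ := fun u : ℕ → γ => u m)
        (measurable_pi_apply m) (measurable_pi_apply m)).measure_inter_preimage_eq_mul
          _ _ (ha m hm) (hb m hm)
    have h2 : μ ((⋂ i ∈ s, U i ⁻¹' a i) ∩ ⋂ i ∈ s, W i ⁻¹' b i)
        = μ (⋂ i ∈ s, U i ⁻¹' a i) * μ (⋂ i ∈ s, W i ⁻¹' b i) := by
      have := hi.measure_inter_preimage_eq_mul _ _
        (MeasurableSet.pi s.countable_toSet fun i hi => ha i hi)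
        (MeasurableSet.pi s.countable_toSet fun i hi => hb i hi)
      simp only [Set.pi_def, Set.preimage_iInter, Finset.mem_coe] at this
      exact this
    rw [hI, h2, hUi.measure_inter_preimage_eq_mul s fun i hi => ha i hi,
      hWi.measure_inter_preimage_eq_mul s fun i hi => hb i hi, ← Finset.prod_mul_distrib]
    exact Finset.prod_congr rfl fun i hi => by rw [hab i hi, h1 i hi]

end Marks

/-! ### The effect of one interfering station -/

/-- The probability that a base station at distance `s` neither is preferred to a server at
distance `r` nor, by its interference, brings the signal-to-interference ratio down to `τ`. -/
def retention (α τ p r s : ℝ) : ℝ :=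
  (if s < r then 1 - p else 1) * (1 + τ * (r / s) ^ α)⁻¹

/-- The exponent `-log (retention α τ p r s)`. -/
def retentionExponent (α τ p r s : ℝ) : ℝ≥0∞ := negLog (ENNReal.ofReal (retention α τ p r s))

open Classical in
/-- The normalized power of an interferer at distance `s` with caching indicator and fading `u`,
infinite if it is preferred to the server at distance `r`. -/
def penalty (α τ r s : ℝ) (u : Prop × ℝ≥0∞) : ℝ≥0∞ :=
  (if u.1 ∧ s < r then ⊤ else 0) + ENNReal.ofReal (τ * (r / s) ^ α) * u.2

open Classical in
/-- The fading of a base station if it caches the file. -/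
def servingFading (u : Prop × ℝ≥0∞) : ℝ≥0∞ := if u.1 then u.2 else 0

theorem measurable_servingFading : Measurable servingFading :=
  Measurable.ite (measurableSet_setOfPred.2 measurable_fst) measurable_snd measurable_const

theorem measurable_ratio_rpow (α τ : ℝ) :
    Measurable fun z : ℝ × ℝ => τ * (z.1 / z.2) ^ α :=
  ((measurable_fst.div measurable_snd).pow_const α).const_mul τ

theorem measurable_penalty (α τ : ℝ) :
    Measurable fun z : (ℝ × ℝ) × (Prop × ℝ≥0∞) => penalty α τ z.1.1 z.1.2 z.2 := by
  refine Measurable.add (Measurable.ite ?_ measurable_const measurable_const) ?_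
  · exact (measurableSet_setOfPred.2 (measurable_fst.comp measurable_snd)).inter
      (measurableSet_lt (measurable_snd.comp measurable_fst) (measurable_fst.comp measurable_fst))
  · exact ((measurable_ratio_rpow α τ).comp measurable_fst).ennreal_ofReal.mul
      (measurable_snd.comp measurable_snd)

theorem measurable_retention (α τ p : ℝ) :
    Measurable fun z : ℝ × ℝ => retention α τ p z.1 z.2 := by
  refine Measurable.mul (Measurable.ite ?_ measurable_const measurable_const) ?_
  · exact measurableSet_lt measurable_snd measurable_fst
  · exact (measurable_const.add (measurable_ratio_rpow α τ)).inv

theorem measurable_retentionExponent (α τ p : ℝ) :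
    Measurable fun z : ℝ × ℝ => retentionExponent α τ p z.1 z.2 :=
  measurable_negLog.comp (measurable_retention α τ p).ennreal_ofReal

theorem ratio_rpow_nonneg {α τ r s : ℝ} (hτ : 0 ≤ τ) (hr : 0 ≤ r) (hs : 0 ≤ s) :
    0 ≤ τ * (r / s) ^ α := by positivity

theorem retention_nonneg {α τ p r s : ℝ} (hτ : 0 ≤ τ) (hp1 : p ≤ 1) (hr : 0 ≤ r) (hs : 0 ≤ s) :
    0 ≤ retention α τ p r s := by
  have := ratio_rpow_nonneg (α := α) hτ hr hs
  unfold retention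
  refine mul_nonneg ?_ (by positivity)
  split_ifs <;> linarith

theorem retention_le_one {α τ p r s : ℝ} (hτ : 0 ≤ τ) (hp0 : 0 ≤ p) (hr : 0 ≤ r)
    (hs : 0 ≤ s) : retention α τ p r s ≤ 1 := by
  have := ratio_rpow_nonneg (α := α) hτ hr hs
  unfold retention
  refine mul_le_one₀ ?_ (by positivity) (inv_le_one_of_one_le₀ (by linarith))
  split_ifs <;> linarith

theorem expNeg_retentionExponent {α τ p r s : ℝ} (hτ : 0 ≤ τ) (hp0 : 0 ≤ p) (hr : 0 ≤ r)
    (hs : 0 ≤ s) :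
    expNeg (retentionExponent α τ p r s) = ENNReal.ofReal (retention α τ p r s) :=
  expNeg_negLog (by simpa using retention_le_one hτ hp0 hr hs)

/-- A farther server leaves more room for preferred stations and has a weaker signal. This
monotonicity lets the distance of a server be replaced by the radii of its annulus. -/
theorem retention_antitone {α τ p r r' s : ℝ} (hα : 0 ≤ α) (hτ : 0 ≤ τ) (hp0 : 0 ≤ p)
    (hp1 : p ≤ 1) (hr : 0 ≤ r) (hs : 0 ≤ s) (h : r ≤ r') :
    retention α τ p r' s ≤ retention α τ p r s := by
  have h1 := ratio_rpow_nonneg (α := α) hτ hr hs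
  have h2 : τ * (r / s) ^ α ≤ τ * (r' / s) ^ α := by gcongr
  unfold retention
  refine mul_le_mul ?_ (inv_anti₀ (by linarith) (by linarith))
    (inv_nonneg.2 (by linarith)) ?_
  · split_ifs <;> linarith
  · split_ifs <;> linarith

theorem retentionExponent_mono {α τ p r r' s : ℝ} (hα : 0 ≤ α) (hτ : 0 ≤ τ) (hp0 : 0 ≤ p)
    (hp1 : p ≤ 1) (hr : 0 ≤ r) (hs : 0 ≤ s) (h : r ≤ r') :
    retentionExponent α τ p r s ≤ retentionExponent α τ p r' s :=
  antitone_negLog (ENNReal.ofReal_le_ofReal (retention_antitone hα hτ hp0 hp1 hr hs h))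

/-! ### Laws of the marks of the stations -/

namespace MacroTier

variable {Ω : Type*} [MeasurableSpace Ω] {μ : Measure Ω} (T : MacroTier μ)

/-- Caching indicator of file `f` and power fading of the `m`-th base station. -/
def mark (f m : ℕ) (ω : Ω) : Prop × ℝ≥0∞ := (f ∈ T.cache m ω, ENNReal.ofReal (‖T.h m ω‖ ^ 2))

theorem measurable_mem_cache (f m : ℕ) : Measurable fun ω => f ∈ T.cache m ω :=
  (measurable_set_mem f).comp (T.cache_measurable m)

theorem measurable_normSq_h (m : ℕ) : Measurable fun ω => ‖T.h m ω‖ ^ 2 :=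
  (T.h_measurable m).norm.pow_const 2

theorem measurable_mark (f m : ℕ) : Measurable (T.mark f m) :=
  (T.measurable_mem_cache f m).prodMk (T.measurable_normSq_h m).ennreal_ofReal

theorem iIndepFun_mark [IsProbabilityMeasure μ] (f : ℕ) : iIndepFun (T.mark f) μ := by
  have h := iIndepFun_prodMk_of_indepFun T.cache_measurable T.h_measurable T.cache_indep T.h_indep
    T.indep_cache_fading
  exact h.comp (fun _ (u : Set ℕ × ℂ) => (f ∈ u.1, ENNReal.ofReal (‖u.2‖ ^ 2)))
    fun _ => ((measurable_set_mem f).comp measurable_fst).prodMk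
      (measurable_snd.norm.pow_const 2).ennreal_ofReal

theorem indepFun_locations_marks (f : ℕ) :
    IndepFun (fun ω n => T.X n ω) (fun ω n => T.mark f n ω) μ := by
  refine T.indep_locations.comp (φ := fun x => x)
    (ψ := fun (u : (ℕ → Set ℕ) × (ℕ → ℂ)) n => (f ∈ u.1 n, ENNReal.ofReal (‖u.2 n‖ ^ 2)))
    measurable_id ?_
  refine measurable_pi_lambda _ fun n => ?_
  exact ((measurable_set_mem f).comp ((measurable_pi_apply n).comp measurable_fst)).prodMk
      (((measurable_pi_apply n).comp measurable_snd).norm.pow_const 2).ennreal_ofReal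

theorem indepFun_cache_fading_apply (f m : ℕ) :
    IndepFun (fun ω => f ∈ T.cache m ω) (fun ω => ENNReal.ofReal (‖T.h m ω‖ ^ 2)) μ :=
  T.indep_cache_fading.comp (φ := fun u : ℕ → Set ℕ => f ∈ u m)
    (ψ := fun u : ℕ → ℂ => ENNReal.ofReal (‖u m‖ ^ 2))
    ((measurable_set_mem f).comp (measurable_pi_apply m))
    ((measurable_pi_apply m).norm.pow_const 2).ennreal_ofReal

variable {f : ℕ}

theorem p_nonneg (hf : f ∈ Finset.Icc 1 T.Hc) : 0 ≤ T.p f := by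
  rw [← T.cache_prob 0 f hf]; exact measureReal_nonneg

theorem p_le_one [IsProbabilityMeasure μ] (hf : f ∈ Finset.Icc 1 T.Hc) : T.p f ≤ 1 := by
  rw [← T.cache_prob 0 f hf]; exact measureReal_le_one

theorem measure_mem_cache [IsProbabilityMeasure μ] (hf : f ∈ Finset.Icc 1 T.Hc) (n : ℕ) :
    μ {ω | f ∈ T.cache n ω} = ENNReal.ofReal (T.p f) := by
  rw [← T.cache_prob n f hf, ofReal_measureReal]

theorem measure_lt_servingFading [IsProbabilityMeasure μ] (hf : f ∈ Finset.Icc 1 T.Hc) (n : ℕ)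
    (t : ℝ≥0∞) :
    μ {ω | t < servingFading (T.mark f n ω)} = ENNReal.ofReal (T.p f) * expNeg t := by
  have e : {ω | t < servingFading (T.mark f n ω)} = (fun ω => f ∈ T.cache n ω) ⁻¹' {True} ∩
      (fun ω => ENNReal.ofReal (‖T.h n ω‖ ^ 2)) ⁻¹' Set.Ioi t := by
    ext ω
    by_cases h : f ∈ T.cache n ω <;> simp [servingFading, mark, h]
  rw [e, (T.indepFun_cache_fading_apply f n).measure_inter_preimage_eq_mul _ _
    (measurableSet_singleton _) measurableSet_Ioi, ← T.measure_mem_cache hf n,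
    ← measure_lt_ofReal_of_map_eq_expMeasure (T.measurable_normSq_h n) (T.rayleigh n) t]
  congr 2
  ext ω
  simp

/-- Caching and fading are independent. The infinite part of the penalty contributes the probability
of not caching when `s < r`, and the fading contributes its Laplace transform `(1 + w)⁻¹` at `w = τ
(r / s) ^ α`. -/
theorem lintegral_expNeg_penalty [IsProbabilityMeasure μ] (hf : f ∈ Finset.Icc 1 T.Hc) (m : ℕ)
    {τ r s : ℝ} (hτ : 0 ≤ τ) (hr : 0 ≤ r) (hs : 0 ≤ s) :
    ∫⁻ ω, expNeg (penalty T.α τ r s (T.mark f m ω)) ∂μ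
      = expNeg (retentionExponent T.α τ (T.p f) r s) := by
  classical
  rw [expNeg_retentionExponent hτ (T.p_nonneg hf) hr hs]
  have hw := ratio_rpow_nonneg (α := T.α) hτ hr hs
  have hm1 : Measurable fun c : Prop => if c ∧ s < r then (0 : ℝ≥0∞) else 1 := Measurable.of_discrete
  have hm2 : Measurable fun t : ℝ≥0∞ => expNeg (ENNReal.ofReal (τ * (r / s) ^ T.α) * t) :=
    measurable_expNeg.comp (measurable_id.const_mul _)
  have e : ∀ ω, expNeg (penalty T.α τ r s (T.mark f m ω))
      = ((fun c : Prop => if c ∧ s < r then (0 : ℝ≥0∞) else 1) ∘ fun ω => f ∈ T.cache m ω) ω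
        * ((fun t : ℝ≥0∞ => expNeg (ENNReal.ofReal (τ * (r / s) ^ T.α) * t)) ∘
          fun ω => ENNReal.ofReal (‖T.h m ω‖ ^ 2)) ω := by
    intro ω
    by_cases h : f ∈ T.cache m ω <;> by_cases h' : s < r <;>
      simp [penalty, mark, h, h']
  simp_rw [e]
  rw [← Pi.mul_def, lintegral_mul_eq_lintegral_mul_lintegral_of_indepFun
    (hm1.comp (T.measurable_mem_cache f m)) (hm2.comp (T.measurable_normSq_h m).ennreal_ofReal)
    ((T.indepFun_cache_fading_apply f m).comp hm1 hm2)]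
  simp only [Function.comp_apply]
  rw [lintegral_expNeg_of_map_eq_expMeasure (T.measurable_normSq_h m) (T.rayleigh m) hw, retention,
    ENNReal.ofReal_mul (by have := T.p_le_one hf; split_ifs <;> linarith)]
  congr 1
  by_cases h : s < r
  · have e2 : (fun ω => if f ∈ T.cache m ω ∧ s < r then (0 : ℝ≥0∞) else 1)
        = {ω | f ∈ T.cache m ω}ᶜ.indicator fun _ => 1 := by
      ext ω
      by_cases h' : f ∈ T.cache m ω <;> simp [h, h']
    have hms : MeasurableSet {ω | f ∈ T.cache m ω} :=
      measurableSet_setOfPred.2 (T.measurable_mem_cache f m)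
    rw [e2, lintegral_indicator_const hms.compl, prob_compl_eq_one_sub hms,
      T.measure_mem_cache hf, one_mul, if_pos h, ENNReal.ofReal_sub _ (T.p_nonneg hf),
      ENNReal.ofReal_one]
  · simp [h]

end MacroTier

/-! ### Success as one inequality between sums of marks -/

namespace MacroTier

variable {Ω : Type*} [MeasurableSpace Ω] {μ : Measure Ω} (T : MacroTier μ) {f : ℕ}

/-- The power received per unit fading from a base station at distance `s`. -/
def meanPower (s : ℝ) : ℝ≥0∞ := ENNReal.ofReal (T.P * T.pathLoss s * T.N)

theorem pathLoss_nonneg {s : ℝ} (hs : 0 ≤ s) : 0 ≤ T.pathLoss s :=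
  mul_nonneg T.C_pos.le (Real.rpow_nonneg hs _)

theorem meanPower_ne_zero {r : ℝ} (hr : 0 < r) : T.meanPower r ≠ 0 := by
  have h1 := T.P_pos
  have h2 := T.C_pos
  have h3 : (0 : ℝ) < T.N := by exact_mod_cast T.N_pos
  have h4 : 0 < r ^ (-T.α) := Real.rpow_pos_of_pos hr _
  have : 0 < T.P * T.pathLoss r * T.N := by unfold pathLoss; positivity
  simpa [meanPower] using this

theorem ofReal_mul_meanPower {τ r s : ℝ} (hτ : 0 ≤ τ) (hr : 0 < r) (hs : 0 ≤ s) :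
    ENNReal.ofReal τ * T.meanPower s
      = T.meanPower r * ENNReal.ofReal (τ * (r / s) ^ T.α) := by
  have h1 := T.P_pos.le
  have h2 := T.C_pos.le
  unfold meanPower pathLoss
  rw [← ENNReal.ofReal_mul hτ, ← ENNReal.ofReal_mul (by positivity)]
  congr 1
  rw [Real.div_rpow hr.le hs, Real.rpow_neg hr.le, Real.rpow_neg hs]
  have : r ^ T.α ≠ 0 := (Real.rpow_pos_of_pos hr _).ne'
  field_simp

theorem interferingPower_eq (m : ℕ) (ω : Ω) :
    T.interferingPower m ω = T.meanPower ‖T.X m ω‖ * ENNReal.ofReal (‖T.h m ω‖ ^ 2) := by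
  have h1 := T.P_pos.le
  have h2 := T.pathLoss_nonneg (norm_nonneg (T.X m ω))
  unfold interferingPower meanPower macroArrayGain
  rw [← ENNReal.ofReal_mul (by positivity)]
  congr 1
  ring

theorem interference_add (n : ℕ) (ω : Ω) (h : f ∈ T.cache n ω) :
    T.interferenceCached f n ω + T.interferenceUncached f ω
      = ∑' m, if m = n then 0 else T.interferingPower m ω := by
  unfold interferenceCached interferenceUncached
  rw [← ENNReal.tsum_add]
  refine tsum_congr fun m => ?_
  by_cases h1 : m = n
  · subst h1; simp [h]
  · by_cases h2 : f ∈ T.cache m ω <;> simp [h1, h2]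

/-- Dividing by the mean power of the server leaves only distance ratios and fading. A closer
caching station makes the left sum infinite, so the single inequality also expresses that the server
is nearest. -/
theorem isServing_and_lt_sinr_iff (hnoise : T.sigmaSq = 0) {τ : ℝ} (hτ : 0 < τ) (n : ℕ) (ω : Ω) :
    T.IsServing f n ω ∧ ENNReal.ofReal τ < T.sinr f n ω ↔
      T.X n ω ≠ 0 ∧ ∑' m, (if m = n then 0 else
        penalty T.α τ ‖T.X n ω‖ ‖T.X m ω‖ (T.mark f m ω)) < servingFading (T.mark f n ω) := by
  by_cases hc : f ∈ T.cache n ω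
  swap
  · simp [servingFading, mark, IsServing, hc]
  by_cases hX : T.X n ω = 0
  -- By the convention `0 ^ (-α) = 0`, a server at the origin has no signal, so both sides fail.
  · have hα : -T.α ≠ 0 := by have := T.two_lt_α; linarith
    simp [hX, sinr, pathLoss, Real.zero_rpow hα]
  have hr : 0 < ‖T.X n ω‖ := norm_pos_iff.2 hX
  have hnum : ENNReal.ofReal (T.P * T.pathLoss ‖T.X n ω‖ * maxGain * T.N * ‖T.h n ω‖ ^ 2)
      = T.meanPower ‖T.X n ω‖ * ENNReal.ofReal (‖T.h n ω‖ ^ 2) := by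
    have h1 := T.P_pos.le
    have h2 := T.pathLoss_nonneg hr.le
    unfold meanPower maxGain
    rw [← ENNReal.ofReal_mul (by positivity), mul_one]
  have hsinr : ENNReal.ofReal τ < T.sinr f n ω ↔
      ∑' m, (if m = n then 0 else ENNReal.ofReal (τ * (‖T.X n ω‖ / ‖T.X m ω‖) ^ T.α)
        * (T.mark f m ω).2) < (T.mark f n ω).2 := by
    unfold sinr
    -- Clearing the denominator is valid for infinite interference too because `τ` is nonzero.
    rw [hnoise, ENNReal.ofReal_zero, zero_add, T.interference_add n ω hc, hnum,
      ENNReal.lt_div_iff_mul_lt (Or.inr ENNReal.ofReal_ne_top)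
        (Or.inr (by simpa using hτ)), ← ENNReal.tsum_mul_left]
    have : ∀ m, (ENNReal.ofReal τ * if m = n then 0 else T.interferingPower m ω)
        = T.meanPower ‖T.X n ω‖ * if m = n then 0 else
          ENNReal.ofReal (τ * (‖T.X n ω‖ / ‖T.X m ω‖) ^ T.α) * (T.mark f m ω).2 := by
      intro m
      by_cases h : m = n
      · simp [h]
      · rw [if_neg h, if_neg h, T.interferingPower_eq, ← mul_assoc,
          T.ofReal_mul_meanPower hτ.le hr (norm_nonneg _), mul_assoc]
        rfl
    simp_rw [this]
    rw [ENNReal.tsum_mul_left, ENNReal.mul_lt_mul_iff_right (T.meanPower_ne_zero hr)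
      (by simp [meanPower])]
    rfl
  rw [hsinr]
  have hV : servingFading (T.mark f n ω) = (T.mark f n ω).2 := if_pos hc
  rw [hV]
  constructor
  · rintro ⟨hs, hlt⟩
    refine ⟨hX, ?_⟩
    refine lt_of_le_of_lt (le_of_eq (tsum_congr fun m => ?_)) hlt
    by_cases h : m = n
    · simp [h]
    · rw [if_neg h, if_neg h, penalty, if_neg, zero_add]
      rintro ⟨h1, h2⟩
      exact absurd (hs.2 m h1) (not_le.2 h2)
  · rintro ⟨_, hlt⟩
    refine ⟨⟨hc, fun m hm => ?_⟩, lt_of_le_of_lt (ENNReal.tsum_le_tsum fun m => ?_) hlt⟩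
    · by_contra hcon
      have hmn : m ≠ n := by rintro rfl; exact hcon le_rfl
      have htop : penalty T.α τ ‖T.X n ω‖ ‖T.X m ω‖ (T.mark f m ω) = ⊤ := by
        rw [penalty, if_pos ⟨hm, not_le.1 hcon⟩, top_add]
      have := ENNReal.le_tsum (f := fun m => if m = n then 0 else
        penalty T.α τ ‖T.X n ω‖ ‖T.X m ω‖ (T.mark f m ω)) m
      simp only [if_neg hmn, htop] at this
      exact absurd (this.trans_lt hlt) not_top_lt
    · by_cases h : m = n
      · simp [h]
      · rw [if_neg h, if_neg h, penalty]
        exact le_add_self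

/-- The event that the `n`-th base station serves with a ratio above `τ`, as a set of locations and
marks. -/
def successSet (α τ : ℝ) (n : ℕ) (B : Set (ℕ → Plane)) :
    Set ((ℕ → Plane) × (ℕ → Prop × ℝ≥0∞)) :=
  {z | z.1 ∈ B ∧ ∑' m, (if m = n then 0 else penalty α τ ‖z.1 n‖ ‖z.1 m‖ (z.2 m))
    < servingFading (z.2 n)}

theorem measurableSet_successSet (α τ : ℝ) (n : ℕ) {B : Set (ℕ → Plane)} (hB : MeasurableSet B) :
    MeasurableSet (successSet α τ n B) := by
  suffices hS : MeasurableSet {z : (ℕ → Plane) × (ℕ → Prop × ℝ≥0∞) |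
      ∑' m, (if m = n then 0 else penalty α τ ‖z.1 n‖ ‖z.1 m‖ (z.2 m))
        < servingFading (z.2 n)} from
    (measurable_fst hB).inter hS
  refine measurableSet_lt (Measurable.tsum fun m => ?_) ?_
  · by_cases h : m = n
    · simp [h]
    · simp only [h, if_false]
      exact (measurable_penalty α τ).comp
        (((((measurable_pi_apply n).comp measurable_fst).norm).prodMk
          (((measurable_pi_apply m).comp measurable_fst).norm)).prodMk
            ((measurable_pi_apply m).comp measurable_snd))
  · exact measurable_servingFading.comp ((measurable_pi_apply n).comp measurable_snd)

/-- Averaging over the marks at fixed locations gives `p` times the product of the retention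
probabilities; only the expectation over the locations remains. -/
theorem measure_successSet [IsProbabilityMeasure μ] (hf : f ∈ Finset.Icc 1 T.Hc) {τ : ℝ}
    (hτ : 0 ≤ τ) (n : ℕ) {B : Set (ℕ → Plane)} (hB : MeasurableSet B) :
    μ {ω | ((fun k => T.X k ω), fun k => T.mark f k ω) ∈ successSet T.α τ n B}
      = ∫⁻ ω, B.indicator (fun x => ENNReal.ofReal (T.p f) * expNeg (∑' m, if m = n then 0 else
          retentionExponent T.α τ (T.p f) ‖x n‖ ‖x m‖)) (fun k => T.X k ω) ∂μ := by
  rw [measure_preimage_prodMk_of_indepFun (measurable_pi_lambda _ T.poisson.measurable)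
    (measurable_pi_lambda _ fun k => T.measurable_mark f k) (T.indepFun_locations_marks f)
    (measurableSet_successSet T.α τ n hB)]
  refine lintegral_congr fun ω => ?_
  by_cases h : (fun k => T.X k ω) ∈ B
  · rw [Set.indicator_of_mem h]
    rw [← measure_tsum_lt_of_iIndepFun (T.measurable_mark f) (T.iIndepFun_mark f) n
      (y := fun m u => penalty T.α τ ‖T.X n ω‖ ‖T.X m ω‖ u)
      (fun m => (measurable_penalty T.α τ).comp
        (measurable_prodMk_left (x := (‖T.X n ω‖, ‖T.X m ω‖)))) measurable_servingFading
      (T.measure_lt_servingFading hf n) fun m _ =>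
        T.lintegral_expNeg_penalty hf m hτ (norm_nonneg _) (norm_nonneg _)]
    congr 1
    ext ω'
    simp [successSet, h]
  · rw [Set.indicator_of_notMem h]
    simp [successSet, h]

end MacroTier

/-! ### Riemann sums of an exponential along a geometric partition -/

section GeometricPartition

variable {Q : ℝ}

theorem iUnion_Ioc_zpow (hQ : 1 < Q) : ⋃ j : ℤ, Set.Ioc (Q ^ j) (Q ^ (j + 1)) = Set.Ioi 0 := by
  ext x
  simp only [Set.mem_iUnion, Set.mem_Ioi]
  constructor
  · rintro ⟨j, hj⟩
    exact (zpow_pos (by linarith) j).trans hj.1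
  · intro hx
    exact exists_mem_Ioc_zpow hx hQ

theorem pairwise_disjoint_Ioc_zpow (hQ : 1 < Q) :
    Pairwise fun i j : ℤ => Disjoint (Set.Ioc (Q ^ i) (Q ^ (i + 1)))
      (Set.Ioc (Q ^ j) (Q ^ (j + 1))) :=
  (zpow_right_strictMono₀ hQ).monotone.pairwise_disjoint_on_Ioc_succ

theorem tsum_lintegral_Ioc_zpow (hQ : 1 < Q) {κ : ℝ} (hκ : 0 < κ) :
    ∑' j : ℤ, ∫⁻ u in Set.Ioc (Q ^ j) (Q ^ (j + 1)), ENNReal.ofReal (Real.exp (-κ * u))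
      = ENNReal.ofReal κ⁻¹ := by
  rw [← lintegral_iUnion (fun j => measurableSet_Ioc) (pairwise_disjoint_Ioc_zpow hQ),
    iUnion_Ioc_zpow hQ, ← ofReal_integral_eq_lintegral_ofReal
    (integrableOn_exp_mul_Ioi (by linarith) 0) (ae_of_all _ fun x => (Real.exp_pos _).le),
    integral_exp_mul_Ioi (by linarith)]
  simp [neg_div_neg_eq]

theorem volume_Ioc_zpow (hQ : Q ≠ 0) (j : ℤ) :
    volume (Set.Ioc (Q ^ j) (Q ^ (j + 1))) = ENNReal.ofReal ((Q - 1) * Q ^ j) := by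
  rw [Real.volume_Ioc, zpow_add_one₀ hQ]
  congr 1; ring

/-- On the interval from `Q ^ j` to `Q ^ (j + 1)` one has `u / Q ≤ Q ^ j`, so the sum lies below the
integral with rate `κ / Q`. -/
theorem tsum_geometric_exp_le (hQ : 1 < Q) {κ : ℝ} (hκ : 0 < κ) :
    ∑' j : ℤ, ENNReal.ofReal ((Q - 1) * Q ^ j * Real.exp (-(κ * Q ^ j)))
      ≤ ENNReal.ofReal (Q / κ) := by
  have hQ0 : 0 < Q := by linarith
  have := tsum_lintegral_Ioc_zpow hQ (div_pos hκ hQ0)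
  rw [inv_div] at this
  rw [← this]
  refine ENNReal.tsum_le_tsum fun j => ?_
  have hj : 0 < Q ^ j := zpow_pos hQ0 j
  rw [ENNReal.ofReal_mul (mul_nonneg (by linarith) hj.le), ← volume_Ioc_zpow hQ0.ne', mul_comm,
    ← setLIntegral_const]
  refine setLIntegral_mono' measurableSet_Ioc fun u hu => ENNReal.ofReal_le_ofReal ?_
  rw [Real.exp_le_exp]
  have h1 : u ≤ Q ^ j * Q := by rw [← zpow_add_one₀ hQ0.ne']; exact hu.2
  have h2 : u / Q ≤ Q ^ j := (div_le_iff₀ hQ0).2 h1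
  have h3 : κ / Q * u = κ * (u / Q) := by ring
  have := mul_le_mul_of_nonneg_left h2 hκ.le
  linarith

/-- The decreasing integrand is at most its value at the left endpoint. -/
theorem le_tsum_geometric_exp (hQ : 1 < Q) {κ : ℝ} (hκ : 0 < κ) :
    ENNReal.ofReal κ⁻¹
      ≤ ∑' j : ℤ, ENNReal.ofReal ((Q - 1) * Q ^ j * Real.exp (-(κ * Q ^ j))) := by
  have hQ0 : 0 < Q := by linarith
  rw [← tsum_lintegral_Ioc_zpow hQ hκ]
  refine ENNReal.tsum_le_tsum fun j => ?_
  have hj : 0 < Q ^ j := zpow_pos hQ0 j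
  rw [ENNReal.ofReal_mul (mul_nonneg (by linarith) hj.le), ← volume_Ioc_zpow hQ0.ne', mul_comm,
    ← setLIntegral_const]
  refine setLIntegral_mono' measurableSet_Ioc fun u hu => ENNReal.ofReal_le_ofReal ?_
  rw [Real.exp_le_exp]
  have := mul_le_mul_of_nonneg_left hu.1.le hκ.le
  linarith

end GeometricPartition

/-! ### Annuli in squared radius, and scaling of the obstruction integral -/

/-- The annulus `a < ‖x‖² ≤ b`. -/
def annulus (a b : ℝ) : Set Plane := {x | ‖x‖ ^ 2 ∈ Set.Ioc a b}

theorem measurableSet_annulus (a b : ℝ) : MeasurableSet (annulus a b) :=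
  (measurable_norm.pow_const 2) measurableSet_Ioc

theorem volume_annulus {a b : ℝ} (ha : 0 ≤ a) (hab : a ≤ b) :
    volume (annulus a b) = ENNReal.ofReal (Real.pi * (b - a)) := by
  have hball : ∀ t : ℝ, 0 ≤ t → volume (Metric.closedBall (0 : Plane) (√t))
      = ENNReal.ofReal (Real.pi * t) := by
    intro t ht
    rw [EuclideanSpace.volume_closedBall, Fintype.card_fin, ← ENNReal.ofReal_pow (Real.sqrt_nonneg _),
      Real.sq_sqrt ht, Real.sq_sqrt Real.pi_pos.le, ← ENNReal.ofReal_mul ht]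
    congr 1
    have : Real.Gamma (((2 : ℕ) : ℝ) / 2 + 1) = 1 := by
      norm_num
    rw [this]; ring
  have e : annulus a b = Metric.closedBall 0 (√b) \ Metric.closedBall 0 (√a) := by
    ext x
    simp only [annulus, Set.mem_ofPred_eq, Set.mem_Ioc, Set.mem_sdiff, mem_closedBall_zero_iff, not_le]
    rw [Real.le_sqrt (norm_nonneg x) (ha.trans hab), Real.sqrt_lt ha (norm_nonneg x), and_comm]
  rw [e, measure_sdiff (Metric.closedBall_subset_closedBall (Real.sqrt_le_sqrt hab))
    Metric.isClosed_closedBall.measurableSet.nullMeasurableSet measure_closedBall_lt_top.ne, hball b (ha.trans hab), hball a ha,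
    ← ENNReal.ofReal_sub _ (mul_nonneg Real.pi_pos.le ha), mul_sub]

/-- The integral over the plane of the probability that a base station obstructs a server at
distance one. -/
def obstruction (α τ p : ℝ) : ℝ≥0∞ :=
  ∫⁻ x : Plane, (1 - ENNReal.ofReal (retention α τ p 1 ‖x‖))

/-- `retention` depends on `s / r` only, and rescaling the plane by `r` multiplies area by `r ^ 2`.
-/
theorem lintegral_one_sub_retention {α τ p r : ℝ} (hr : 0 < r) :
    ∫⁻ x : Plane, (1 - ENNReal.ofReal (retention α τ p r ‖x‖))
      = ENNReal.ofReal (r ^ 2) * obstruction α τ p := by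
  have hm : Measurable fun x : Plane => 1 - ENNReal.ofReal (retention α τ p 1 ‖x‖) :=
    measurable_const.sub (((measurable_retention α τ p).comp
      (measurable_const.prodMk measurable_norm)).ennreal_ofReal)
  have e : ∀ x : Plane, retention α τ p r ‖x‖ = retention α τ p 1 ‖r⁻¹ • x‖ := by
    intro x
    have h1 : ‖r⁻¹ • x‖ = ‖x‖ / r := by
      rw [norm_smul, Real.norm_of_nonneg (inv_nonneg.2 hr.le)]; ring
    have h2 : ‖x‖ / r < 1 ↔ ‖x‖ < r := div_lt_one hr
    simp only [retention, h1, h2, one_div_div]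
  simp_rw [e]
  rw [obstruction, ← lintegral_map (f := fun x : Plane => 1 - ENNReal.ofReal (retention α τ p 1 ‖x‖))
    hm (measurable_const_smul r⁻¹), Measure.map_addHaar_smul _ (inv_ne_zero hr.ne'),
    lintegral_smul_measure]
  simp [abs_of_pos hr]

section Bounds

variable {α τ p : ℝ}

/-- The retention exponent of a base station at `x`, with the set `A` left out. -/
def offExponent (α τ p r : ℝ) (A : Set Plane) (x : Plane) : ℝ≥0∞ :=
  Aᶜ.indicator (fun x => retentionExponent α τ p r ‖x‖) x

theorem measurable_offExponent (r : ℝ) {A : Set Plane} (hA : MeasurableSet A) :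
    Measurable (offExponent α τ p r A) :=
  ((measurable_retentionExponent α τ p).comp
      (measurable_const.prodMk measurable_norm)).indicator hA.compl

/-- The integrand is at most one, so leaving out `A` loses at most its volume. -/
theorem le_lintegral_offExponent_add (hτ : 0 ≤ τ) (hp0 : 0 ≤ p) {r : ℝ} (hr : 0 < r)
    {A : Set Plane} (hA : MeasurableSet A) :
    ENNReal.ofReal (r ^ 2) * obstruction α τ p
      ≤ (∫⁻ x, (1 - expNeg (offExponent α τ p r A x))) + volume A := by
  rw [← lintegral_one_sub_retention hr, ← lintegral_indicator_one hA,
    ← lintegral_add_right _ (measurable_one.indicator hA)]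
  refine lintegral_mono fun x => ?_
  by_cases hx : x ∈ A
  · rw [Set.indicator_of_mem hx]
    exact tsub_le_self.trans le_add_self
  · rw [Set.indicator_of_notMem hx, add_zero, offExponent, Set.indicator_of_mem (by exact hx),
      expNeg_retentionExponent hτ hp0 hr.le (norm_nonneg x)]

theorem lintegral_offExponent_le (hτ : 0 ≤ τ) (hp0 : 0 ≤ p) {r : ℝ} (hr : 0 < r)
    (A : Set Plane) :
    ∫⁻ x, (1 - expNeg (offExponent α τ p r A x))
      ≤ ENNReal.ofReal (r ^ 2) * obstruction α τ p := by
  rw [← lintegral_one_sub_retention hr]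
  refine lintegral_mono fun x => ?_
  by_cases hx : x ∈ A
  · rw [offExponent, Set.indicator_of_notMem (by simpa using hx)]
    simp
  · rw [offExponent, Set.indicator_of_mem (by exact hx),
      expNeg_retentionExponent hτ hp0 hr.le (norm_nonneg x)]

end Bounds

/-- The `n`-th point is the only one in `A`. -/
def onlyPoint (A : Set Plane) (n : ℕ) : Set (ℕ → Plane) := {x | x n ∈ A ∧ ∀ m, m ≠ n → x m ∉ A}

theorem measurableSet_onlyPoint {A : Set Plane} (hA : MeasurableSet A) (n : ℕ) :
    MeasurableSet (onlyPoint A n) := by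
  have : onlyPoint A n = {x | x n ∈ A} ∩ ⋂ m, {x | m ≠ n → x m ∉ A} := by
    ext x; simp [onlyPoint]
  rw [this]
  refine MeasurableSet.inter (measurable_pi_apply n hA) (MeasurableSet.iInter fun m => ?_)
  by_cases h : m = n
  · simp [h]
  · simp only [ne_eq, h, not_false_eq_true, forall_const]
    exact (measurable_pi_apply m : Measurable fun x : ℕ → Plane => x m) hA.compl

theorem exists_mem_onlyPoint {Ω : Type*} {X : ℕ → Ω → Plane} {A : Set Plane} {ω : Ω}
    (h : pointCount X A ω = 1) : ∃ n, (fun k => X k ω) ∈ onlyPoint A n := by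
  have h1 : ∃ n, X n ω ∈ A := by
    by_contra! hcon
    have : pointCount X A ω = 0 := by
      unfold pointCount
      rw [ENNReal.tsum_eq_zero]
      exact fun n => Set.indicator_of_notMem (hcon n) _
    rw [h] at this
    exact one_ne_zero this
  obtain ⟨n, hn⟩ := h1
  refine ⟨n, hn, fun m hmn hm => ?_⟩
  have := ENNReal.sum_le_tsum (f := fun n => A.indicator (fun _ => (1 : ℝ≥0∞)) (X n ω)) {m, n}
  rw [Finset.sum_pair hmn, Set.indicator_of_mem hm, Set.indicator_of_mem hn] at this
  change _ ≤ pointCount X A ω at this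
  rw [h] at this
  norm_num at this

/-! ### Upper and lower bounds for a server in one annulus -/

namespace MacroTier

variable {Ω : Type*} [MeasurableSpace Ω] {μ : Measure Ω} (T : MacroTier μ) {f : ℕ} {τ : ℝ}

/-- The event that the `n`-th base station serves the user, with a ratio above `τ`. -/
def successEvent (f : ℕ) (τ : ℝ) (n : ℕ) : Set Ω :=
  {ω | T.IsServing f n ω ∧ ENNReal.ofReal τ < T.sinr f n ω}

theorem setOf_successSet (hnoise : T.sigmaSq = 0) (hτ : 0 < τ) (n : ℕ) {B : Set (ℕ → Plane)}
    (hB : ∀ x ∈ B, x n ≠ 0) :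
    {ω | ((fun k => T.X k ω), fun k => T.mark f k ω) ∈ successSet T.α τ n B}
      = {ω | ω ∈ T.successEvent f τ n ∧ (fun k => T.X k ω) ∈ B} := by
  ext ω
  have := T.isServing_and_lt_sinr_iff hnoise hτ n ω (f := f)
  constructor
  · rintro ⟨h1, h2⟩
    exact ⟨this.2 ⟨hB _ h1, h2⟩, h1⟩
  · rintro ⟨h1, h2⟩
    exact ⟨h2, (this.1 h1).2⟩

theorem ne_zero_of_mem_annulus {a b : ℝ} (ha : 0 ≤ a) {x : Plane} (hx : x ∈ annulus a b) :
    x ≠ 0 := by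
  rintro rfl
  have : a < ‖(0 : Plane)‖ ^ 2 := hx.1
  simp at this
  linarith

theorem measurable_offSum [IsProbabilityMeasure μ] (r : ℝ) {A : Set Plane}
    (hA : MeasurableSet A) :
    Measurable fun ω => expNeg (∑' m, offExponent T.α τ (T.p f) r A (T.X m ω)) :=
  measurable_expNeg.comp (Measurable.tsum fun m =>
    (measurable_offExponent r hA).comp (T.poisson.measurable m))

/-- Lowering the server distance to `√a` and ignoring interferers inside the annulus only raises the
success probability, and makes it the same for all candidates `n`. Summing over `n` then yields the
count in the annulus, independent of the points outside. -/
theorem tsum_measure_successEvent_le [IsProbabilityMeasure μ] (hnoise : T.sigmaSq = 0)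
    (hf : f ∈ Finset.Icc 1 T.Hc) (hτ : 0 < τ) {a b : ℝ} (ha : 0 < a) (hab : a ≤ b) :
    ∑' n, μ {ω | ω ∈ T.successEvent f τ n ∧ T.X n ω ∈ annulus a b}
      ≤ ENNReal.ofReal (T.p f) * (ENNReal.ofReal T.lam * volume (annulus a b) *
        expNeg (ENNReal.ofReal T.lam *
          ∫⁻ x, (1 - expNeg (offExponent T.α τ (T.p f) (√a) (annulus a b) x)))) := by
  have hα : 0 ≤ T.α := by have := T.two_lt_α; linarith
  set A := annulus a b with hAdef
  have hA : MeasurableSet A := measurableSet_annulus a b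
  have hv : volume A ≠ ∞ := by rw [hAdef, volume_annulus ha.le hab]; exact ENNReal.ofReal_ne_top
  have hl := T.lam_pos.le
  have hEN := T.poisson.lintegral_pointCount hl hA hv
  have key := T.poisson.lintegral_mul_expNeg_tsum hl hA hv (F := fun t => t) measurable_id
    (by rw [hEN]; exact ENNReal.mul_ne_top ENNReal.ofReal_ne_top hv)
    (measurable_offExponent (α := T.α) (τ := τ) (p := T.p f) (√a) hA)
    (fun x hx => Set.indicator_of_notMem (by simpa using hx) _)
  rw [hEN] at key
  have hmul : Measurable fun ω => pointCount T.X A ω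
      * expNeg (∑' m, offExponent T.α τ (T.p f) (√a) A (T.X m ω)) :=
    (measurable_pointCount T.poisson.measurable hA).mul (T.measurable_offSum _ hA)
  rw [← key, ← lintegral_const_mul _ hmul]
  have hBm : ∀ n, MeasurableSet {x : ℕ → Plane | x n ∈ A} := fun n => measurable_pi_apply n hA
  have e : ∀ n, μ {ω | ω ∈ T.successEvent f τ n ∧ T.X n ω ∈ A}
      = ∫⁻ ω, {x : ℕ → Plane | x n ∈ A}.indicator (fun x => ENNReal.ofReal (T.p f) *
        expNeg (∑' m, if m = n then 0 else
          retentionExponent T.α τ (T.p f) ‖x n‖ ‖x m‖)) (fun k => T.X k ω) ∂μ := by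
    intro n
    rw [← T.measure_successSet hf hτ.le n (hBm n), T.setOf_successSet hnoise hτ n
      (B := {x | x n ∈ A}) fun x hx => ne_zero_of_mem_annulus (b := b) ha.le hx]
    rfl
  have hle : ∀ n, μ {ω | ω ∈ T.successEvent f τ n ∧ T.X n ω ∈ A}
      ≤ ∫⁻ ω, A.indicator (fun _ => (1 : ℝ≥0∞)) (T.X n ω) * (ENNReal.ofReal (T.p f) *
        expNeg (∑' m, offExponent T.α τ (T.p f) (√a) A (T.X m ω))) ∂μ := by
    intro n
    rw [e]
    refine lintegral_mono fun ω => ?_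
    by_cases h : T.X n ω ∈ A
    · rw [Set.indicator_of_mem (by exact h), Set.indicator_of_mem h, one_mul]
      refine mul_le_mul_right (antitone_expNeg (ENNReal.tsum_le_tsum fun m => ?_)) _
      by_cases hm : T.X m ω ∈ A
      · rw [offExponent, Set.indicator_of_notMem (by simpa using hm)]
        exact zero_le
      · have hmn : m ≠ n := by rintro rfl; exact hm h
        rw [offExponent, Set.indicator_of_mem (by exact hm), if_neg hmn]
        refine retentionExponent_mono hα hτ.le (T.p_nonneg hf) (T.p_le_one hf)
          (Real.sqrt_nonneg _) (norm_nonneg _) ?_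
        rw [← Real.sqrt_sq (norm_nonneg (T.X n ω))]
        exact Real.sqrt_le_sqrt h.1.le
    · rw [Set.indicator_of_notMem (by exact h)]
      exact zero_le
  refine (ENNReal.tsum_le_tsum hle).trans (le_of_eq ?_)
  rw [← lintegral_tsum fun n => ?_]
  · refine lintegral_congr fun ω => ?_
    rw [ENNReal.tsum_mul_right]
    change pointCount T.X A ω * _ = _
    ring
  · exact (((measurable_const.indicator hA).comp (T.poisson.measurable n)).mul
      ((T.measurable_offSum _ hA).const_mul _)).aemeasurable

/-- When the annulus holds exactly one point, the interferers are precisely the points off the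
annulus, and raising the server distance to `√b` lowers the success probability. These events are
disjoint in `n`, so no overlap is lost. -/
theorem le_measure_successEvent [IsProbabilityMeasure μ] (hnoise : T.sigmaSq = 0)
    (hf : f ∈ Finset.Icc 1 T.Hc) (hτ : 0 < τ) {a b : ℝ} (ha : 0 < a) (hab : a ≤ b) :
    ENNReal.ofReal (T.p f) *
        (ENNReal.ofReal (IsHomogeneousPoisson.weight T.lam (annulus a b) 1) *
        expNeg (ENNReal.ofReal T.lam *
          ∫⁻ x, (1 - expNeg (offExponent T.α τ (T.p f) (√b) (annulus a b) x))))
      ≤ μ (⋃ n, {ω | ω ∈ T.successEvent f τ n ∧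
          (fun k => T.X k ω) ∈ onlyPoint (annulus a b) n}) := by
  classical
  have hα : 0 ≤ T.α := by have := T.two_lt_α; linarith
  set A := annulus a b with hAdef
  have hA : MeasurableSet A := measurableSet_annulus a b
  have hv : volume A ≠ ∞ := by rw [hAdef, volume_annulus ha.le hab]; exact ENNReal.ofReal_ne_top
  have hl := T.lam_pos.le
  -- Selects the event of exactly one point, whose probability is the Poisson weight at one.
  let F : ℝ≥0∞ → ℝ≥0∞ := Set.indicator {1} fun _ => 1
  have hF : Measurable F := measurable_const.indicator (measurableSet_singleton 1)
  have hN : Measurable (pointCount T.X A) := measurable_pointCount T.poisson.measurable hA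
  have hEN : ∫⁻ ω, F (pointCount T.X A ω) ∂μ
      = ENNReal.ofReal (IsHomogeneousPoisson.weight T.lam A 1) := by
    rw [← T.poisson.measure_pointCount_eq hA hv 1, ← lintegral_indicator_one
      (measurableSet_eq_fun hN measurable_const)]
    refine lintegral_congr fun ω => ?_
    by_cases h : pointCount T.X A ω = 1 <;> simp [F, h]
  have key := T.poisson.lintegral_mul_expNeg_tsum hl hA hv hF
    (by rw [hEN]; exact ENNReal.ofReal_ne_top)
    (measurable_offExponent (α := T.α) (τ := τ) (p := T.p f) (√b) hA)
    (fun x hx => Set.indicator_of_notMem (by simpa using hx) _)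
  rw [hEN] at key
  have hmul : Measurable fun ω => F (pointCount T.X A ω)
      * expNeg (∑' m, offExponent T.α τ (T.p f) (√b) A (T.X m ω)) :=
    (hF.comp hN).mul (T.measurable_offSum _ hA)
  rw [← key, ← lintegral_const_mul _ hmul]
  have hBm := measurableSet_onlyPoint hA
  have hS : ∀ n, {ω | ω ∈ T.successEvent f τ n ∧ (fun k => T.X k ω) ∈ onlyPoint A n}
      = {ω | ((fun k => T.X k ω), fun k => T.mark f k ω)
          ∈ successSet T.α τ n (onlyPoint A n)} := fun n =>
    (T.setOf_successSet hnoise hτ n fun x hx => ne_zero_of_mem_annulus ha.le hx.1).symm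
  have hXU : Measurable fun ω => ((fun k => T.X k ω), fun k => T.mark f k ω) :=
    (measurable_pi_lambda _ T.poisson.measurable).prodMk
      (measurable_pi_lambda _ fun k => T.measurable_mark f k)
  rw [measure_iUnion]
  rotate_left
  · intro i j hij
    refine Set.disjoint_left.2 fun ω hi hj => ?_
    exact hi.2.2 j hij.symm hj.2.1
  · intro n
    rw [hS]
    exact hXU (measurableSet_successSet T.α τ n (hBm n))
  let g : ℕ → (ℕ → Plane) → ℝ≥0∞ := fun n x => ENNReal.ofReal (T.p f) *
    expNeg (∑' m, if m = n then 0 else retentionExponent T.α τ (T.p f) ‖x n‖ ‖x m‖)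
  have hnorm : ∀ n, Measurable fun x : ℕ → Plane => ‖x n‖ := fun n =>
    measurable_norm.comp (measurable_pi_apply n)
  have hg : ∀ n, Measurable (g n) := by
    intro n
    have hpair : ∀ m, Measurable fun x : ℕ → Plane =>
        retentionExponent T.α τ (T.p f) ‖x n‖ ‖x m‖ := fun m =>
      Measurable.comp (g := fun z : ℝ × ℝ => retentionExponent T.α τ (T.p f) z.1 z.2)
        (f := fun x : ℕ → Plane => (‖x n‖, ‖x m‖)) (measurable_retentionExponent T.α τ (T.p f))
        ((hnorm n).prodMk (hnorm m))
    refine Measurable.const_mul (measurable_expNeg.comp (Measurable.tsum fun m => ?_)) _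
    by_cases h : m = n
    · simp [h]
    · simp only [h, if_false]
      exact hpair m
  have e : ∀ n, μ {ω | ω ∈ T.successEvent f τ n ∧ (fun k => T.X k ω) ∈ onlyPoint A n}
      = ∫⁻ ω, (onlyPoint A n).indicator (g n) (fun k => T.X k ω) ∂μ := fun n => by
    rw [hS, T.measure_successSet hf hτ.le n (hBm n)]
  have hgX : ∀ n, Measurable fun ω => (onlyPoint A n).indicator (g n) (fun k => T.X k ω) :=
    fun n => ((hg n).indicator (hBm n)).comp (measurable_pi_lambda _ T.poisson.measurable)
  simp_rw [e]
  rw [← lintegral_tsum fun n => (hgX n).aemeasurable]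
  refine lintegral_mono fun ω => ?_
  by_cases h : pointCount T.X A ω = 1
  swap
  · simp [F, h]
  obtain ⟨n, hn⟩ := exists_mem_onlyPoint h
  refine le_trans ?_ (ENNReal.le_tsum n)
  rw [Set.indicator_of_mem hn, h]
  simp only [F, g, Set.indicator_of_mem (Set.mem_singleton (1 : ℝ≥0∞)), one_mul]
  refine mul_le_mul_right (antitone_expNeg (ENNReal.tsum_le_tsum fun m => ?_)) _
  by_cases hmn : m = n
  · simp [hmn]
  · rw [if_neg hmn, offExponent, Set.indicator_of_mem (by exact hn.2 m hmn)]
    refine retentionExponent_mono hα hτ.le (T.p_nonneg hf) (T.p_le_one hf)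
      (norm_nonneg _) (norm_nonneg _) ?_
    exact Real.le_sqrt_of_sq_le hn.1.2

end MacroTier

/-! ### Summation over the annuli and the limit `Q → 1` -/

namespace MacroTier

variable {Ω : Type*} [MeasurableSpace Ω] {μ : Measure Ω} (T : MacroTier μ) {f : ℕ} {τ : ℝ}

/-- The rate is `c` less `Q - 1`: the omitted annulus has area `π a (Q - 1)`. -/
theorem tsum_measure_successEvent_annulus_le [IsProbabilityMeasure μ] (hnoise : T.sigmaSq = 0)
    (hf : f ∈ Finset.Icc 1 T.Hc) (hτ : 0 < τ) {c : ℝ}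
    (hobs : obstruction T.α τ (T.p f) = ENNReal.ofReal (Real.pi * c))
    {a Q : ℝ} (ha : 0 < a) (hQ : 1 < Q) (hQc : Q - 1 < c) :
    ∑' n, μ {ω | ω ∈ T.successEvent f τ n ∧ T.X n ω ∈ annulus a (a * Q)}
      ≤ ENNReal.ofReal (T.p f * T.lam * Real.pi) * ENNReal.ofReal
        ((Q - 1) * a * Real.exp (-(T.lam * Real.pi * (c - (Q - 1)) * a))) := by
  have hab : a ≤ a * Q := le_mul_of_one_le_right ha.le hQ.le
  have hp := T.p_nonneg hf
  have hl := T.lam_pos.le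
  have hpi := Real.pi_pos.le
  have hv := volume_annulus ha.le hab
  have hc' : 0 ≤ c - (Q - 1) := by linarith
  have hQ' : 0 ≤ Q - 1 := by linarith
  have hlow := le_lintegral_offExponent_add (α := T.α) hτ.le hp (Real.sqrt_pos.2 ha)
    (measurableSet_annulus a (a * Q))
  rw [Real.sq_sqrt ha.le, hobs, ← ENNReal.ofReal_mul ha.le, hv] at hlow
  have hlow' : ENNReal.ofReal (Real.pi * (c - (Q - 1)) * a) ≤
      ∫⁻ x, (1 - expNeg (offExponent T.α τ (T.p f) (√a) (annulus a (a * Q)) x)) := by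
    refine le_trans (le_of_eq ?_) (tsub_le_iff_right.2 hlow)
    rw [← ENNReal.ofReal_sub _ (mul_nonneg hpi (by linarith))]
    congr 1; ring
  refine (T.tsum_measure_successEvent_le hnoise hf hτ ha hab).trans ?_
  have h1 : expNeg (ENNReal.ofReal T.lam *
      ∫⁻ x, (1 - expNeg (offExponent T.α τ (T.p f) (√a) (annulus a (a * Q)) x)))
      ≤ ENNReal.ofReal (Real.exp (-(T.lam * Real.pi * (c - (Q - 1)) * a))) := by
    refine (antitone_expNeg (mul_le_mul_right hlow' _)).trans (le_of_eq ?_)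
    rw [← ENNReal.ofReal_mul hl, expNeg_ofReal (by positivity)]
    congr 2; ring_nf
  refine (mul_le_mul_right (mul_le_mul_right h1 _) _).trans (le_of_eq ?_)
  have h2 : 0 ≤ Real.pi * (a * Q - a) := mul_nonneg hpi (by linarith)
  rw [hv, ← ENNReal.ofReal_mul hl, ← ENNReal.ofReal_mul (by positivity),
    ← ENNReal.ofReal_mul (by positivity), ← ENNReal.ofReal_mul (by positivity)]
  congr 1; ring

/-- In the rate, `Q - 1` comes from excluding a second point in the annulus, and `Q * c` from taking
the outer radius squared, `a * Q`. -/
theorem le_measure_successEvent_annulus [IsProbabilityMeasure μ] (hnoise : T.sigmaSq = 0)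
    (hf : f ∈ Finset.Icc 1 T.Hc) (hτ : 0 < τ) {c : ℝ} (hc : 0 < c)
    (hobs : obstruction T.α τ (T.p f) = ENNReal.ofReal (Real.pi * c))
    {a Q : ℝ} (ha : 0 < a) (hQ : 1 < Q) :
    ENNReal.ofReal (T.p f * T.lam * Real.pi) * ENNReal.ofReal
        ((Q - 1) * a * Real.exp (-(T.lam * Real.pi * (Q - 1 + Q * c) * a)))
      ≤ μ (⋃ n, {ω | ω ∈ T.successEvent f τ n ∧
          (fun k => T.X k ω) ∈ onlyPoint (annulus a (a * Q)) n}) := by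
  have hab : a ≤ a * Q := le_mul_of_one_le_right ha.le hQ.le
  have hp := T.p_nonneg hf
  have hl := T.lam_pos.le
  have hpi := Real.pi_pos.le
  have hv := volume_annulus ha.le hab
  have hQ' : 0 ≤ Q - 1 := by linarith
  have hb : 0 < a * Q := ha.trans_le hab
  have h2 : 0 ≤ Real.pi * (a * Q - a) := mul_nonneg hpi (by linarith)
  have hup := lintegral_offExponent_le (α := T.α) hτ.le hp (Real.sqrt_pos.2 hb)
    (annulus a (a * Q))
  rw [Real.sq_sqrt hb.le, hobs, ← ENNReal.ofReal_mul hb.le] at hup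
  refine le_trans ?_ (T.le_measure_successEvent hnoise hf hτ ha hab)
  have h1 : ENNReal.ofReal (Real.exp (-(T.lam * (a * Q * (Real.pi * c))))) ≤
      expNeg (ENNReal.ofReal T.lam *
        ∫⁻ x, (1 - expNeg (offExponent T.α τ (T.p f) (√(a * Q)) (annulus a (a * Q)) x))) := by
    refine le_trans (le_of_eq ?_) (antitone_expNeg (mul_le_mul_right hup _))
    rw [← ENNReal.ofReal_mul hl, expNeg_ofReal (by positivity)]
  refine le_trans (le_of_eq ?_) (mul_le_mul_right (mul_le_mul_right h1 _) _)
  have hvr : volume.real (annulus a (a * Q)) = Real.pi * (a * Q - a) := by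
    rw [Measure.real, hv, ENNReal.toReal_ofReal h2]
  rw [IsHomogeneousPoisson.weight, hvr, ← ENNReal.ofReal_mul (by positivity),
    ← ENNReal.ofReal_mul (by positivity), ← ENNReal.ofReal_mul (by positivity)]
  congr 1
  have : Real.exp (-(T.lam * Real.pi * (Q - 1 + Q * c) * a))
      = Real.exp (-(T.lam * (Real.pi * (a * Q - a)))) *
        Real.exp (-(T.lam * (a * Q * (Real.pi * c)))) := by
    rw [← Real.exp_add]; congr 1; ring
  rw [this, pow_one, Nat.factorial_one, Nat.cast_one, div_one]
  ring

theorem coverage_eq_measure_iUnion (f : ℕ) (τ : ℝ) :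
    T.coverage f τ = μ.real (⋃ n, T.successEvent f τ n) := by
  unfold coverage
  congr 1
  ext ω
  simp [successEvent]

theorem measure_iUnion_successEvent_le [IsProbabilityMeasure μ] (hnoise : T.sigmaSq = 0)
    (hf : f ∈ Finset.Icc 1 T.Hc) (hτ : 0 < τ) {c : ℝ}
    (hobs : obstruction T.α τ (T.p f) = ENNReal.ofReal (Real.pi * c))
    {Q : ℝ} (hQ : 1 < Q) (hQc : Q - 1 < c) :
    μ (⋃ n, T.successEvent f τ n) ≤ ENNReal.ofReal (T.p f * Q / (c - (Q - 1))) := by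
  have hQ0 : 0 < Q := by linarith
  have hsub : ⋃ n, T.successEvent f τ n ⊆ ⋃ (j : ℤ) (n : ℕ),
      {ω | ω ∈ T.successEvent f τ n ∧ T.X n ω ∈ annulus (Q ^ j) (Q ^ j * Q)} := by
    intro ω hω
    obtain ⟨n, hn⟩ := Set.mem_iUnion.1 hω
    have hX : T.X n ω ≠ 0 := ((T.isServing_and_lt_sinr_iff hnoise hτ n ω).1 hn).1
    obtain ⟨j, hj⟩ := exists_mem_Ioc_zpow (x := ‖T.X n ω‖ ^ 2)
      (pow_pos (norm_pos_iff.2 hX) 2) hQ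
    rw [zpow_add_one₀ hQ0.ne'] at hj
    exact Set.mem_iUnion.2 ⟨j, Set.mem_iUnion.2 ⟨n, hn, hj⟩⟩
  have hκ : 0 < T.lam * Real.pi * (c - (Q - 1)) :=
    mul_pos (mul_pos T.lam_pos Real.pi_pos) (by linarith)
  calc μ (⋃ n, T.successEvent f τ n)
      ≤ ∑' j : ℤ, ∑' n, μ {ω | ω ∈ T.successEvent f τ n ∧
          T.X n ω ∈ annulus (Q ^ j) (Q ^ j * Q)} :=
        (measure_mono hsub).trans ((measure_iUnion_le _).trans
          (ENNReal.tsum_le_tsum fun j => measure_iUnion_le _))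
    _ ≤ ∑' j : ℤ, ENNReal.ofReal (T.p f * T.lam * Real.pi) * ENNReal.ofReal
        ((Q - 1) * Q ^ j * Real.exp (-(T.lam * Real.pi * (c - (Q - 1)) * Q ^ j))) :=
        ENNReal.tsum_le_tsum fun j => T.tsum_measure_successEvent_annulus_le hnoise hf hτ hobs
          (zpow_pos hQ0 j) hQ hQc
    _ ≤ ENNReal.ofReal (T.p f * T.lam * Real.pi) *
        ENNReal.ofReal (Q / (T.lam * Real.pi * (c - (Q - 1)))) := by
        rw [ENNReal.tsum_mul_left]
        exact mul_le_mul_right (tsum_geometric_exp_le hQ hκ) _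
    _ = _ := by
        rw [← ENNReal.ofReal_mul (mul_nonneg (mul_nonneg (T.p_nonneg hf) T.lam_pos.le)
          Real.pi_pos.le)]
        congr 1
        have h1 := T.lam_pos.ne'
        have h2 := Real.pi_pos.ne'
        have h3 : c - (Q - 1) ≠ 0 := by linarith
        field_simp

theorem le_measure_iUnion_successEvent [IsProbabilityMeasure μ] (hnoise : T.sigmaSq = 0)
    (hf : f ∈ Finset.Icc 1 T.Hc) (hτ : 0 < τ) {c : ℝ} (hc : 0 < c)
    (hobs : obstruction T.α τ (T.p f) = ENNReal.ofReal (Real.pi * c)) {Q : ℝ} (hQ : 1 < Q) :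
    ENNReal.ofReal (T.p f / (Q - 1 + Q * c)) ≤ μ (⋃ n, T.successEvent f τ n) := by
  have hQ0 : 0 < Q := by linarith
  have hden : 0 < Q - 1 + Q * c := by have := mul_pos hQ0 hc; linarith
  have hκ : 0 < T.lam * Real.pi * (Q - 1 + Q * c) :=
    mul_pos (mul_pos T.lam_pos Real.pi_pos) hden
  let S : ℤ → Set Ω := fun j => ⋃ n, {ω | ω ∈ T.successEvent f τ n ∧
    (fun k => T.X k ω) ∈ onlyPoint (annulus (Q ^ j) (Q ^ j * Q)) n}
  have hSm : ∀ j, MeasurableSet (S j) := by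
    refine fun j => MeasurableSet.iUnion fun n => ?_
    rw [← T.setOf_successSet hnoise hτ n fun x hx =>
      ne_zero_of_mem_annulus (zpow_pos hQ0 j).le hx.1]
    exact ((measurable_pi_lambda _ T.poisson.measurable).prodMk
      (measurable_pi_lambda _ fun k => T.measurable_mark f k))
      (measurableSet_successSet T.α τ n (measurableSet_onlyPoint (measurableSet_annulus _ _) n))
  have hSd : Pairwise fun i j => Disjoint (S i) (S j) := by
    intro i j hij
    refine Set.disjoint_left.2 fun ω hi hj => ?_
    obtain ⟨n, hn, hn1, -⟩ := Set.mem_iUnion.1 hi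
    obtain ⟨m, hm, hm1, -⟩ := Set.mem_iUnion.1 hj
    -- Two serving stations are equidistant, so ties cannot produce success in two different annuli.
    have hnorm : ‖T.X n ω‖ = ‖T.X m ω‖ := le_antisymm (hn.1.2 m hm.1.1) (hm.1.2 n hn.1.1)
    have h1 : ‖T.X n ω‖ ^ 2 ∈ Set.Ioc (Q ^ i) (Q ^ i * Q) := hn1
    have h2 : ‖T.X m ω‖ ^ 2 ∈ Set.Ioc (Q ^ j) (Q ^ j * Q) := hm1
    rw [← zpow_add_one₀ hQ0.ne'] at h1 h2
    rw [← hnorm] at h2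
    exact Set.disjoint_left.1 (pairwise_disjoint_Ioc_zpow hQ hij) h1 h2
  calc ENNReal.ofReal (T.p f / (Q - 1 + Q * c))
      = ENNReal.ofReal (T.p f * T.lam * Real.pi) *
        ENNReal.ofReal (T.lam * Real.pi * (Q - 1 + Q * c))⁻¹ := by
        rw [← ENNReal.ofReal_mul (mul_nonneg (mul_nonneg (T.p_nonneg hf) T.lam_pos.le)
          Real.pi_pos.le)]
        congr 1
        have h1 := T.lam_pos.ne'
        have h2 := Real.pi_pos.ne'
        field_simp
    _ ≤ ∑' j : ℤ, ENNReal.ofReal (T.p f * T.lam * Real.pi) * ENNReal.ofReal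
        ((Q - 1) * Q ^ j * Real.exp (-(T.lam * Real.pi * (Q - 1 + Q * c) * Q ^ j))) := by
        rw [ENNReal.tsum_mul_left]
        exact mul_le_mul_right (le_tsum_geometric_exp hQ hκ) _
    _ ≤ ∑' j : ℤ, μ (S j) :=
        ENNReal.tsum_le_tsum fun j => T.le_measure_successEvent_annulus hnoise hf hτ hc hobs
          (zpow_pos hQ0 j) hQ
    _ = μ (⋃ j, S j) := (measure_iUnion hSd hSm).symm
    _ ≤ _ := measure_mono (Set.iUnion_subset fun j => Set.iUnion_mono fun n ω hω => hω.1)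

/-- Both bounds, `p Q / (c - (Q - 1))` and `p / (Q - 1 + Q c)`, tend to `p / c` as `Q` decreases to
one. -/
theorem coverage_eq_div [IsProbabilityMeasure μ] (hnoise : T.sigmaSq = 0)
    (hf : f ∈ Finset.Icc 1 T.Hc) (hτ : 0 < τ) {c : ℝ} (hc : 0 < c)
    (hobs : obstruction T.α τ (T.p f) = ENNReal.ofReal (Real.pi * c)) :
    T.coverage f τ = T.p f / c := by
  rw [coverage_eq_measure_iUnion]
  have hp := T.p_nonneg hf
  have hev : ∀ᶠ Q in 𝓝[>] (1 : ℝ), 1 < Q ∧ Q - 1 < c := by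
    have h1 : ∀ᶠ Q in 𝓝[>] (1 : ℝ), Q < 1 + c :=
      nhdsWithin_le_nhds (eventually_lt_nhds (by linarith))
    filter_upwards [self_mem_nhdsWithin, h1] with Q hQ hQc
    exact ⟨hQ, by linarith⟩
  have hup : Tendsto (fun Q : ℝ => T.p f * Q / (c - (Q - 1))) (𝓝[>] 1) (𝓝 (T.p f / c)) := by
    have : ContinuousAt (fun Q : ℝ => T.p f * Q / (c - (Q - 1))) 1 :=
      ContinuousAt.div (by fun_prop) (by fun_prop) (by simpa using hc.ne')
    simpa [ContinuousAt] using this.tendsto.mono_left nhdsWithin_le_nhds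
  have hlo : Tendsto (fun Q : ℝ => T.p f / (Q - 1 + Q * c)) (𝓝[>] 1) (𝓝 (T.p f / c)) := by
    have : ContinuousAt (fun Q : ℝ => T.p f / (Q - 1 + Q * c)) 1 :=
      ContinuousAt.div (by fun_prop) (by fun_prop) (by simpa using hc.ne')
    simpa [ContinuousAt] using this.tendsto.mono_left nhdsWithin_le_nhds
  refine le_antisymm (ge_of_tendsto hup ?_) (le_of_tendsto hlo ?_)
  · filter_upwards [hev] with Q hQ
    exact ENNReal.toReal_le_of_le_ofReal
      (div_nonneg (mul_nonneg hp (by linarith)) (by linarith))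
      (T.measure_iUnion_successEvent_le hnoise hf hτ hobs hQ.1 hQ.2)
  · filter_upwards [hev] with Q hQ
    rw [Measure.real, ← ENNReal.ofReal_le_iff_le_toReal (measure_ne_top _ _)]
    exact T.le_measure_iUnion_successEvent hnoise hf hτ hc hobs hQ.1

end MacroTier

/-! ### Analytic continuation of the hypergeometric series -/

section Hypergeometric

theorem ascPochhammer_eval_mul_add {R : Type*} [CommRing R] (a : R) (n : ℕ) :
    (ascPochhammer R n).eval a * (a + n) = a * (ascPochhammer R n).eval (a + 1) := by
  rw [← ascPochhammer_succ_eval, ascPochhammer_succ_left]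
  simp [Polynomial.eval_comp]

theorem ascPochhammer_eval_ne_zero_of_pos {x : ℝ} (hx : 0 < x) (n : ℕ) :
    (ascPochhammer ℝ n).eval x ≠ 0 := (ascPochhammer_pos n x hx).ne'

/-- The Pochhammer symbols at `-δ` and `1 - δ` are shifted products, so their quotient telescopes to
`-δ / (n - δ)`; the one at `1` cancels the factorial. -/
theorem ordinaryHypergeometric_neg_one_eq_tsum {δ : ℝ} (hδ0 : 0 < δ) (hδ1 : δ < 1) (y : ℝ) :
    ordinaryHypergeometric (-δ) 1 (1 - δ) y = ∑' n : ℕ, -δ / (n - δ) * y ^ n := by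
  rw [ordinaryHypergeometric_eq_tsum]
  refine tsum_congr fun n => ?_
  have h1 := ascPochhammer_eval_mul_add (-δ) n
  have h2 := ascPochhammer_eval_ne_zero_of_pos (x := 1 - δ) (by linarith) n
  have h3 : (ascPochhammer ℝ n).eval (1 : ℝ) = n.factorial := by
    rw [ascPochhammer_eval_one]
  have h4 : (n.factorial : ℝ) ≠ 0 := by positivity
  have h5 : (n : ℝ) - δ ≠ 0 := by
    rcases n with _ | n
    · simp [hδ0.ne']
    · push_cast
      have : (0 : ℝ) ≤ n := Nat.cast_nonneg n
      linarith
  rw [show -δ + 1 = 1 - δ by ring] at h1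
  have h6 : (ascPochhammer ℝ n).eval (-δ) = -δ * (ascPochhammer ℝ n).eval (1 - δ) / (n - δ) := by
    rw [eq_div_iff h5, ← h1]; ring
  rw [h3, h6, smul_eq_mul]
  field_simp

/-- A Stieltjes type integral representing `₂F₁(-2/α, 1; 1 - 2/α; ·)`. -/
def stieltjes (α : ℝ) (z : ℂ) : ℂ := ∫ t : ℝ in Set.Ioi 1, (t : ℂ) / (((t ^ α : ℝ) : ℂ) - z)

variable {α : ℝ}

theorem le_norm_rpow_sub {ε : ℝ} (hα : 0 ≤ α) (hε1 : ε ≤ 1) {z : ℂ} (hz : z.re ≤ 1 - ε) {t : ℝ}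
    (ht : 1 < t) : ε * t ^ α ≤ ‖((t ^ α : ℝ) : ℂ) - z‖ := by
  have h1 : 1 ≤ t ^ α := Real.one_le_rpow ht.le hα
  have h2 := (le_abs_self _).trans (Complex.abs_re_le_norm (((t ^ α : ℝ) : ℂ) - z))
  rw [Complex.sub_re, Complex.ofReal_re] at h2
  nlinarith [mul_nonneg (sub_nonneg.2 hε1) (sub_nonneg.2 h1)]

theorem rpow_sub_ne_zero (hα : 0 ≤ α) {z : ℂ} (hz : z.re < 1) {t : ℝ} (ht : 1 < t) :
    ((t ^ α : ℝ) : ℂ) - z ≠ 0 := by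
  have h1 : 1 ≤ t ^ α := Real.one_le_rpow ht.le hα
  intro h
  have := congrArg Complex.re h
  rw [Complex.sub_re, Complex.ofReal_re, Complex.zero_re] at this
  linarith

theorem measurable_stieltjes_integrand (α : ℝ) (z : ℂ) (k : ℕ) :
    Measurable fun t : ℝ => (t : ℂ) / (((t ^ α : ℝ) : ℂ) - z) ^ k :=
  Complex.measurable_ofReal.div
    (((Complex.measurable_ofReal.comp (measurable_id.pow_const α)).sub measurable_const).pow_const k)

theorem norm_stieltjes_integrand_le {ε : ℝ} (hα : 0 ≤ α) (hε : 0 < ε) (hε1 : ε ≤ 1) {z : ℂ}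
    (hz : z.re ≤ 1 - ε) {t : ℝ} (ht : 1 < t) (k : ℕ) :
    ‖(t : ℂ) / (((t ^ α : ℝ) : ℂ) - z) ^ k‖ ≤ (ε ^ k)⁻¹ * t ^ (1 - α * k) := by
  have ht0 : 0 < t := by linarith
  have h0 : 0 < t ^ α := Real.rpow_pos_of_pos ht0 α
  have h1 := le_norm_rpow_sub hα hε1 hz ht
  rw [norm_div, norm_pow, Complex.norm_real, Real.norm_of_nonneg ht0.le]
  have h2 : (ε * t ^ α) ^ k ≤ ‖((t ^ α : ℝ) : ℂ) - z‖ ^ k := by gcongr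
  refine (div_le_div_of_nonneg_left ht0.le (by positivity) h2).trans (le_of_eq ?_)
  rw [Real.rpow_sub ht0, Real.rpow_one, Real.rpow_mul ht0.le, Real.rpow_natCast, mul_pow]
  field_simp

/-- Differentiation under the integral sign; since `α > 2`, the dominating powers of `t` are
integrable at infinity. -/
theorem differentiableOn_stieltjes (hα : 2 < α) :
    DifferentiableOn ℂ (stieltjes α) {z | z.re < 1} := by
  intro z₀ hz₀
  have hα0 : 0 ≤ α := by linarith
  -- Half the distance to the line `re z = 1`, so that the ball of radius `ε` keeps distance `ε`
  -- from it.
  set ε : ℝ := min 1 ((1 - z₀.re) / 2) with hε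
  have hz₀' : z₀.re < 1 := hz₀
  have hε0 : 0 < ε := lt_min one_pos (by linarith)
  have hε1 : ε ≤ 1 := min_le_left _ _
  have hball : ∀ z ∈ Metric.ball z₀ ε, z.re ≤ 1 - ε := by
    intro z hz
    have h1 : (z - z₀).re ≤ ‖z - z₀‖ := (le_abs_self _).trans (Complex.abs_re_le_norm _)
    have h2 : ‖z - z₀‖ < ε := by simpa [dist_eq_norm] using hz
    have h3 : ε ≤ (1 - z₀.re) / 2 := min_le_right _ _
    rw [Complex.sub_re] at h1
    linarith
  have hint : ∀ k : ℕ, 1 ≤ k → IntegrableOn (fun t : ℝ => (ε ^ k)⁻¹ * t ^ (1 - α * k))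
      (Set.Ioi 1) := by
    intro k hk
    refine (integrableOn_Ioi_rpow_of_lt ?_ one_pos).const_mul _
    have : (1 : ℝ) ≤ k := by exact_mod_cast hk
    nlinarith
  have hae : ∀ᵐ t : ℝ ∂(volume.restrict (Set.Ioi 1)), 1 < t := by
    filter_upwards [ae_restrict_mem measurableSet_Ioi] with t ht using ht
  have key := hasDerivAt_integral_of_dominated_loc_of_deriv_le
    (μ := volume.restrict (Set.Ioi (1 : ℝ)))
    (F := fun (z : ℂ) (t : ℝ) => (t : ℂ) / (((t ^ α : ℝ) : ℂ) - z))
    (F' := fun (z : ℂ) (t : ℝ) => (t : ℂ) / (((t ^ α : ℝ) : ℂ) - z) ^ 2)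
    (bound := fun t : ℝ => (ε ^ 2)⁻¹ * t ^ (1 - α * (2 : ℕ))) (x₀ := z₀)
    (Metric.ball_mem_nhds z₀ hε0)
    (Eventually.of_forall fun z => by
      simpa using (measurable_stieltjes_integrand α z 1).aestronglyMeasurable)
    ?_ (measurable_stieltjes_integrand α z₀ 2).aestronglyMeasurable
    (by
      filter_upwards [hae] with t ht z hz
      exact norm_stieltjes_integrand_le hα0 hε0 hε1 (hball z hz) ht 2)
    (hint 2 one_le_two) ?_
  · exact key.2.differentiableAt.differentiableWithinAt
  · refine (hint 1 le_rfl).mono' (by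
      simpa using (measurable_stieltjes_integrand α z₀ 1).aestronglyMeasurable) ?_
    filter_upwards [hae] with t ht
    simpa using norm_stieltjes_integrand_le hα0 hε0 hε1 (hball z₀ (Metric.mem_ball_self hε0)) ht 1
  · filter_upwards [hae] with t ht z hz
    have hne := rpow_sub_ne_zero hα0 (z := z) (by have := hball z hz; linarith) ht
    have h := ((hasDerivAt_id z).const_sub ((t ^ α : ℝ) : ℂ)).fun_inv hne |>.const_mul (t : ℂ)
    simpa [div_eq_mul_inv] using h

/-- The analytic continuation of `₂F₁(-2/α, 1; 1 - 2/α; ·)` to `(-∞, 1)`. -/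
def hypContinuation (α y : ℝ) : ℝ := 1 - 2 * y * ∫ t : ℝ in Set.Ioi 1, t / (t ^ α - y)

/-- Complex differentiability of the Stieltjes integral gives analyticity; restricting to the reals
and taking the real part preserves it. -/
theorem analyticOnNhd_hypContinuation (hα : 2 < α) :
    AnalyticOnNhd ℝ (hypContinuation α) (Set.Iio 1) := by
  intro y hy
  have hopen : IsOpen {z : ℂ | z.re < 1} := isOpen_lt Complex.continuous_re continuous_const
  have h1 : AnalyticAt ℂ (stieltjes α) (y : ℂ) :=
    (differentiableOn_stieltjes hα).analyticOnNhd hopen y (by simpa using hy)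
  have h2 : AnalyticAt ℝ (fun x : ℝ => (stieltjes α (x : ℂ)).re) y := by
    have h3 : AnalyticAt ℝ (fun x : ℝ => stieltjes α (x : ℂ)) y :=
      h1.restrictScalars.comp (Complex.ofRealCLM.analyticAt y)
    exact (Complex.reCLM.analyticAt _).comp h3
  have h4 : ∀ x : ℝ, ∫ t : ℝ in Set.Ioi 1, t / (t ^ α - x) = (stieltjes α (x : ℂ)).re := by
    intro x
    rw [stieltjes, ← Complex.ofReal_re (∫ t : ℝ in Set.Ioi 1, t / (t ^ α - x)),
      ← integral_complex_ofReal]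
    simp
  unfold hypContinuation
  simp_rw [h4]
  exact analyticAt_const.sub ((analyticAt_const.mul analyticAt_id).mul h2)

/-- Expand `t / (t ^ α - y)` as a geometric series in `y / t ^ α` and integrate termwise: the `k`-th
power integrates to `1 / (α (k + 1) - 2)`. -/
theorem hypContinuation_eq_ordinaryHypergeometric (hα : 2 < α) {y : ℝ} (hy : |y| < 1) :
    hypContinuation α y = ordinaryHypergeometric (-(2 / α)) 1 (1 - 2 / α) y := by
  have hα0 : 0 < α := by linarith
  rw [ordinaryHypergeometric_neg_one_eq_tsum (by positivity) ((div_lt_one hα0).2 hα)]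
  let F : ℕ → ℝ → ℝ := fun k t => y ^ k * t ^ (1 - α * (k + 1))
  have hexp : ∀ k : ℕ, 1 - α * ((k : ℝ) + 1) < -1 := fun k => by
    have : (0 : ℝ) ≤ k := Nat.cast_nonneg k
    nlinarith
  have hFint : ∀ k, Integrable (F k) (volume.restrict (Set.Ioi 1)) := fun k =>
    (integrableOn_Ioi_rpow_of_lt (hexp k) one_pos).const_mul _
  have hval : ∀ k : ℕ, ∫ t : ℝ in Set.Ioi 1, t ^ (1 - α * ((k : ℝ) + 1))
      = (α * (k + 1) - 2)⁻¹ := fun k => by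
    rw [integral_Ioi_rpow_of_lt (hexp k) one_pos, Real.one_rpow,
      show 1 - α * ((k : ℝ) + 1) + 1 = -(α * (k + 1) - 2) by ring, neg_div_neg_eq, one_div]
  have hFsum : Summable fun k => ∫ t, ‖F k t‖ ∂(volume.restrict (Set.Ioi 1)) := by
    have e : ∀ k, ∫ t, ‖F k t‖ ∂(volume.restrict (Set.Ioi 1)) = |y| ^ k * (α * (k + 1) - 2)⁻¹ := by
      intro k
      rw [← hval k, ← integral_const_mul]
      refine setIntegral_congr_fun measurableSet_Ioi fun t ht => ?_
      have ht0 : (0 : ℝ) < t := one_pos.trans ht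
      simp only [F]
      rw [norm_mul, norm_pow, Real.norm_eq_abs, Real.norm_of_nonneg (Real.rpow_nonneg ht0.le _)]
    simp_rw [e]
    refine Summable.of_nonneg_of_le (fun k => ?_) (fun k => ?_)
      ((summable_geometric_of_lt_one (abs_nonneg y) hy).mul_right (α - 2)⁻¹)
    · have : 0 < α * ((k : ℝ) + 1) - 2 := by have := hexp k; linarith
      positivity
    · have : (0 : ℝ) ≤ k := Nat.cast_nonneg k
      gcongr
      nlinarith
  have hs := hasSum_integral_of_summable_integral_norm hFint hFsum
  have hpt : ∫ t, (∑' k, F k t) ∂(volume.restrict (Set.Ioi 1))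
      = ∫ t : ℝ in Set.Ioi 1, t / (t ^ α - y) := by
    refine setIntegral_congr_fun measurableSet_Ioi fun t ht => ?_
    have ht1 : (1 : ℝ) < t := ht
    have ht0 : (0 : ℝ) < t := one_pos.trans ht
    have h1 : 1 ≤ t ^ α := Real.one_le_rpow ht1.le hα0.le
    have hr : ‖y / t ^ α‖ < 1 := by
      rw [norm_div, Real.norm_eq_abs, Real.norm_of_nonneg (by linarith), div_lt_one (by linarith)]
      linarith
    have e : ∀ k, F k t = t / t ^ α * (y / t ^ α) ^ k := by
      intro k
      simp only [F]
      rw [Real.rpow_sub ht0, Real.rpow_one, Real.rpow_mul ht0.le, Real.rpow_add_one (by positivity),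
        Real.rpow_natCast, div_pow]
      field_simp
    have hne : t ^ α - y ≠ 0 := by have := (abs_lt.1 hy).2; linarith
    have hne' : t ^ α ≠ 0 := by positivity
    simp only [e]
    rw [tsum_mul_left, tsum_geometric_of_norm_lt_one hr]
    field_simp
  rw [hpt] at hs
  -- The integral supplies the terms from index one on; the term of index zero is the constant `1`.
  have hs2 : HasSum (fun k : ℕ => -(2 / α) / (((k + 1 : ℕ) : ℝ) - 2 / α) * y ^ (k + 1))
      (-(2 * y * ∫ t : ℝ in Set.Ioi 1, t / (t ^ α - y))) := by
    have := hs.mul_left (-(2 * y))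
    rw [neg_mul] at this
    convert! this using 1
    ext k
    simp only [F]
    rw [integral_const_mul, hval k]
    have h1 : α * ((k : ℝ) + 1) - 2 ≠ 0 := by have := hexp k; linarith
    have h2 : ((k + 1 : ℕ) : ℝ) - 2 / α ≠ 0 := by
      push_cast
      intro h
      apply h1
      field_simp at h
      linarith
    push_cast at h2 ⊢
    field_simp
    ring
  have hs3 := (hasSum_nat_add_iff (f := fun n : ℕ => -(2 / α) / ((n : ℝ) - 2 / α) * y ^ n) 1).1 hs2
  rw [hs3.tsum_eq, hypContinuation]
  have : (2 / α : ℝ) ≠ 0 := by positivity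
  simp [this]
  ring

theorem hypS_one_zero (hα : 2 < α) {τ : ℝ} (hτ : -1 < τ) :
    hypS α 1 0 τ = hypContinuation α (-τ) := by
  have := gaussHypergeometric_eq_of_analyticOnNhd (analyticOnNhd_hypContinuation hα)
    (fun y hy => hypContinuation_eq_ordinaryHypergeometric hα hy) (x := -τ) (by linarith)
  rw [← this, hypS]
  simp

end Hypergeometric

/-! ### Evaluation of the obstruction integral -/

section Obstruction

variable {α τ p : ℝ}

theorem ofReal_div_add_rpow_eq_lintegral (hτ : 0 < τ) {t : ℝ} (ht : 0 < t) :
    ENNReal.ofReal (t * (τ / (τ + t ^ α)))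
      = ∫⁻ s in Set.Ioi (0 : ℝ), ENNReal.ofReal (τ * Real.exp (-τ * s)) *
          ENNReal.ofReal (t * Real.exp (-s * t ^ α)) := by
  have h0 : 0 < t ^ α := Real.rpow_pos_of_pos ht α
  have hneg : -(τ + t ^ α) < 0 := by linarith
  have e : ∀ s : ℝ, ENNReal.ofReal (τ * Real.exp (-τ * s)) *
      ENNReal.ofReal (t * Real.exp (-s * t ^ α))
      = ENNReal.ofReal (t * τ * Real.exp (-(τ + t ^ α) * s)) := by
    intro s
    rw [← ENNReal.ofReal_mul (by positivity)]
    congr 1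
    rw [show -(τ + t ^ α) * s = -τ * s + -s * t ^ α by ring, Real.exp_add]
    ring
  simp_rw [e]
  rw [← ofReal_integral_eq_lintegral_ofReal ((integrableOn_exp_mul_Ioi hneg 0).const_mul _)
    (ae_of_all _ fun s => by positivity), integral_const_mul, integral_exp_mul_Ioi hneg]
  congr 1
  rw [mul_zero, Real.exp_zero, neg_div_neg_eq]
  ring

theorem lintegral_mul_exp_neg_mul_rpow (hα : 0 < α) {s : ℝ} (hs : 0 < s) :
    ∫⁻ t in Set.Ioi (0 : ℝ), ENNReal.ofReal (t * Real.exp (-s * t ^ α))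
      = ENNReal.ofReal (s ^ (-(2 / α)) * (1 / α) * Real.Gamma (2 / α)) := by
  have h := integral_rpow_mul_exp_neg_mul_rpow (p := α) (q := 1) hα (by norm_num) hs
  have hpos : 0 < s ^ (-(2 / α)) * (1 / α) * Real.Gamma (2 / α) := by
    have := Real.Gamma_pos_of_pos (s := 2 / α) (by positivity)
    positivity
  rw [show (1 : ℝ) + 1 = 2 by norm_num, neg_div] at h
  simp only [Real.rpow_one] at h
  rw [← h, ofReal_integral_eq_lintegral_ofReal]
  -- A nonintegrable function would have integral zero, whereas the value is positive.
  · exact not_imp_comm.1 integral_undef (by rw [h]; exact hpos.ne')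
  · filter_upwards [ae_restrict_mem measurableSet_Ioi] with t ht
    have : (0 : ℝ) < t := ht
    positivity

/-- Writing the fraction as a Laplace integral in `s` and swapping by Tonelli separates the
variables: the `t`-integral yields `Γ(2/α)`, the `s`-integral `Γ(1 - 2/α)`, and the functional
equation turns the first into `Γ(1 + 2/α)`. -/
theorem lintegral_div_add_rpow (hα : 2 < α) (hτ : 0 < τ) :
    ∫⁻ t in Set.Ioi (0 : ℝ), ENNReal.ofReal (t * (τ / (τ + t ^ α)))
      = ENNReal.ofReal (gammaDelta α 1 τ / 2) := by
  have hα0 : 0 < α := by linarith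
  have hδ : 2 / α < 1 := (div_lt_one hα0).2 hα
  have hδ0 : 0 < 2 / α := by positivity
  have hG1 := Real.Gamma_pos_of_pos hδ0
  have hG2 := Real.Gamma_pos_of_pos (s := 1 - 2 / α) (by linarith)
  rw [setLIntegral_congr_fun measurableSet_Ioi fun t ht =>
    ofReal_div_add_rpow_eq_lintegral (α := α) hτ ht, lintegral_lintegral_swap]
  swap
  · refine Measurable.aemeasurable ?_
    refine Measurable.mul (ENNReal.measurable_ofReal.comp ?_) (ENNReal.measurable_ofReal.comp ?_)
    · fun_prop
    · exact measurable_fst.mul (Real.measurable_exp.comp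
        (measurable_snd.neg.mul (measurable_fst.pow_const α)))
  have e : ∀ s ∈ Set.Ioi (0 : ℝ), ∫⁻ t in Set.Ioi (0 : ℝ), ENNReal.ofReal (τ * Real.exp (-τ * s)) *
      ENNReal.ofReal (t * Real.exp (-s * t ^ α))
      = ENNReal.ofReal (τ * (1 / α) * Real.Gamma (2 / α) *
        (s ^ ((1 - 2 / α) - 1) * Real.exp (-(τ * s)))) := by
    intro s hs
    have hs' : (0 : ℝ) < s := hs
    rw [lintegral_const_mul' _ _ ENNReal.ofReal_ne_top, lintegral_mul_exp_neg_mul_rpow hα0 hs',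
      ← ENNReal.ofReal_mul (by positivity)]
    congr 1
    rw [show 1 - 2 / α - 1 = -(2 / α) by ring, neg_mul]
    ring
  rw [setLIntegral_congr_fun measurableSet_Ioi e]
  have h := Real.integral_rpow_mul_exp_neg_mul_Ioi (a := 1 - 2 / α) (r := τ) (by linarith) hτ
  have hpos : 0 < (1 / τ) ^ (1 - 2 / α) * Real.Gamma (1 - 2 / α) := by positivity
  rw [← ofReal_integral_eq_lintegral_ofReal]
  · rw [integral_const_mul, h]
    congr 1
    have h1 : Real.Gamma (1 + 2 / α) = 2 / α * Real.Gamma (2 / α) := by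
      rw [add_comm, Real.Gamma_add_one hδ0.ne']
    have h2 : (1 / τ) ^ (1 - 2 / α) = τ ^ (2 / α) / τ := by
      rw [one_div, Real.inv_rpow hτ.le, ← Real.rpow_neg hτ.le,
        show -(1 - 2 / α) = 2 / α - 1 by ring, Real.rpow_sub hτ, Real.rpow_one]
    rw [gammaDelta, Nat.cast_one, h1, h2, Real.Gamma_one]
    field_simp
  · have hi : Integrable (fun t : ℝ => t ^ (1 - 2 / α - 1) * Real.exp (-(τ * t)))
        (volume.restrict (Set.Ioi 0)) :=
      not_imp_comm.1 integral_undef (by rw [h]; exact hpos.ne')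
    exact hi.const_mul _
  · filter_upwards [ae_restrict_mem measurableSet_Ioi] with s hs
    have : (0 : ℝ) < s := hs
    positivity

theorem gammaDelta_pos (hα : 2 < α) (hτ : 0 < τ) : 0 < gammaDelta α 1 τ := by
  have hα0 : 0 < α := by linarith
  have hδ : 2 / α < 1 := (div_lt_one hα0).2 hα
  have hδ0 : 0 < 2 / α := by positivity
  have hG1 := Real.Gamma_pos_of_pos (s := ((1 : ℕ) : ℝ) + 2 / α) (by positivity)
  have hG2 := Real.Gamma_pos_of_pos (s := 1 - 2 / α) (by linarith)
  have hG3 := Real.Gamma_pos_of_pos (s := ((1 : ℕ) : ℝ)) (by norm_num)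
  unfold gammaDelta
  positivity

theorem measurable_mul_div_add_rpow : Measurable fun t : ℝ => t * (τ / (τ + t ^ α)) :=
  measurable_id.mul (measurable_const.div (measurable_const.add (measurable_id.pow_const α)))

theorem integrableOn_div_add_rpow (hα : 2 < α) (hτ : 0 < τ) :
    IntegrableOn (fun t : ℝ => t * (τ / (τ + t ^ α))) (Set.Ioi 0) := by
  refine ⟨measurable_mul_div_add_rpow.aestronglyMeasurable, ?_⟩
  rw [hasFiniteIntegral_iff_ofReal, lintegral_div_add_rpow hα hτ]
  · exact ENNReal.ofReal_lt_top
  · filter_upwards [ae_restrict_mem measurableSet_Ioi] with t ht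
    have : (0 : ℝ) < t := ht
    positivity

theorem integral_div_add_rpow (hα : 2 < α) (hτ : 0 < τ) :
    ∫ t in Set.Ioi (0 : ℝ), t * (τ / (τ + t ^ α)) = gammaDelta α 1 τ / 2 := by
  rw [integral_eq_lintegral_of_nonneg_ae _ measurable_mul_div_add_rpow.aestronglyMeasurable,
    lintegral_div_add_rpow hα hτ, ENNReal.toReal_ofReal (by
      have := gammaDelta_pos hα hτ; positivity)]
  filter_upwards [ae_restrict_mem measurableSet_Ioi] with t ht
  have : (0 : ℝ) < t := ht
  simp only [Pi.zero_apply]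
  positivity

theorem hypS_eq_one_add_integral (hα : 2 < α) (hτ : 0 < τ) :
    hypS α 1 0 τ = 1 + 2 * ∫ t in Set.Ioi (1 : ℝ), t * (τ / (τ + t ^ α)) := by
  rw [hypS_one_zero hα (by linarith), hypContinuation]
  have : ∫ t in Set.Ioi (1 : ℝ), t * (τ / (τ + t ^ α))
      = τ * ∫ t in Set.Ioi (1 : ℝ), t / (t ^ α - -τ) := by
    rw [← integral_const_mul]
    congr 1
    ext t
    rw [sub_neg_eq_add, add_comm]
    ring
  rw [this]
  ring

theorem one_le_hypS (hα : 2 < α) (hτ : 0 < τ) : 1 ≤ hypS α 1 0 τ := by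
  rw [hypS_eq_one_add_integral hα hτ]
  have : 0 ≤ ∫ t in Set.Ioi (1 : ℝ), t * (τ / (τ + t ^ α)) := by
    refine setIntegral_nonneg measurableSet_Ioi fun t ht => ?_
    have : (0 : ℝ) < t := one_pos.trans ht
    positivity
  linarith

/-- With `w = τ / (τ + t ^ α)`, the loss `1 - retention` is `(1 - p) w + p` for `t < 1` and `w = (1
- p) w + p w` beyond. The weights `1 - p` and `p` become those of `gammaDelta` and `hypS`. -/
theorem mul_one_sub_retention (hτ : 0 < τ) {t : ℝ} (ht : 0 < t) :
    t * (1 - retention α τ p 1 t) = (1 - p) * (t * (τ / (τ + t ^ α)))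
      + p * ((Set.Ioo 0 1).indicator (fun t => t) t
        + (Set.Ici 1).indicator (fun t => t * (τ / (τ + t ^ α))) t) := by
  have h0 : 0 < t ^ α := Real.rpow_pos_of_pos ht α
  have h1 : (1 + τ * (1 / t) ^ α)⁻¹ = 1 - τ / (τ + t ^ α) := by
    rw [one_div, Real.inv_rpow ht.le]
    field_simp
    ring
  unfold retention
  rw [h1]
  by_cases h : t < 1
  · rw [if_pos h, Set.indicator_of_mem (Set.mem_Ioo.2 ⟨ht, h⟩), Set.indicator_of_notMem (by simpa using h)]
    ring
  · rw [if_neg h, Set.indicator_of_notMem (fun h' => h h'.2),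
      Set.indicator_of_mem (by simpa using h)]
    ring

theorem obstruction_eq (hα : 2 < α) (hτ : 0 < τ) (hp0 : 0 ≤ p) (hp1 : p ≤ 1) :
    obstruction α τ p
      = ENNReal.ofReal (Real.pi * (p * hypS α 1 0 τ + (1 - p) * gammaDelta α 1 τ)) := by
  have hJ := integrableOn_div_add_rpow hα hτ
  have hA : IntegrableOn ((Set.Ioo 0 1).indicator fun t : ℝ => t) (Set.Ioi 0) :=
    ((integrable_indicator_iff measurableSet_Ioo).2
      ((continuous_id.integrableOn_Icc (a := (0 : ℝ)) (b := 1)).mono_set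
        Set.Ioo_subset_Icc_self)).integrableOn
  have hB : IntegrableOn ((Set.Ici 1).indicator fun t : ℝ => t * (τ / (τ + t ^ α)))
      (Set.Ioi 0) := hJ.indicator measurableSet_Ici
  have hdim : Module.finrank ℝ Plane = 2 := by simp
  have hcongr : ∀ t ∈ Set.Ioi (0 : ℝ), t ^ (Module.finrank ℝ Plane - 1) • (1 - retention α τ p 1 t)
      = (1 - p) * (t * (τ / (τ + t ^ α)))
      + p * ((Set.Ioo 0 1).indicator (fun t => t) t
        + (Set.Ici 1).indicator (fun t => t * (τ / (τ + t ^ α))) t) := by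
    intro t ht
    rw [← mul_one_sub_retention hτ ht, hdim, smul_eq_mul]
    norm_num
  have hint : IntegrableOn (fun t => (1 - p) * (t * (τ / (τ + t ^ α)))
      + p * ((Set.Ioo 0 1).indicator (fun t => t) t
        + (Set.Ici 1).indicator (fun t => t * (τ / (τ + t ^ α))) t)) (Set.Ioi 0) :=
    (hJ.const_mul (1 - p)).add ((hA.add hB).const_mul p)
  have hAB : IntegrableOn (fun t => (Set.Ioo 0 1).indicator (fun t => t) t
      + (Set.Ici 1).indicator (fun t => t * (τ / (τ + t ^ α))) t) (Set.Ioi 0) := hA.add hB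
  have hintk : Integrable (fun x : Plane => 1 - retention α τ p 1 ‖x‖) :=
    (integrable_fun_norm_addHaar volume (f := fun t => 1 - retention α τ p 1 t)).2
      (hint.congr_fun (fun t ht => (hcongr t ht).symm) measurableSet_Ioi)
  have e : ∀ x : Plane, 1 - ENNReal.ofReal (retention α τ p 1 ‖x‖)
      = ENNReal.ofReal (1 - retention α τ p 1 ‖x‖) := fun x => by
    rw [ENNReal.ofReal_sub _ (retention_nonneg hτ.le hp1 zero_le_one (norm_nonneg x)),
      ENNReal.ofReal_one]
  unfold obstruction
  simp_rw [e]
  rw [← ofReal_integral_eq_lintegral_ofReal hintk (ae_of_all _ fun x =>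
    sub_nonneg.2 (retention_le_one hτ.le hp0 zero_le_one (norm_nonneg x))),
    -- Polar coordinates give `2 π ∫ t (1 - retention)`. The unit disc contributes `p π`, matching
    -- the leading `1` in the integral formula for `hypS`.
    integral_fun_norm_addHaar volume (fun t => 1 - retention α τ p 1 t),
    setIntegral_congr_fun measurableSet_Ioi hcongr,
    integral_add (hJ.const_mul (1 - p)) (hAB.const_mul p), integral_const_mul,
    integral_const_mul, integral_add hA hB, integral_div_add_rpow hα hτ,
    setIntegral_indicator measurableSet_Ioo, setIntegral_indicator measurableSet_Ici,
    hypS_eq_one_add_integral hα hτ, hdim]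
  have hv : volume.real (Metric.ball (0 : Plane) 1) = Real.pi := by
    rw [Measure.real, EuclideanSpace.volume_ball_fin_two]
    simp [Real.pi_pos.le]
  have h1 : ∫ t in Set.Ioi (0 : ℝ) ∩ Set.Ioo 0 1, t = 1 / 2 := by
    rw [Set.inter_eq_right.2 fun t ht => ht.1, ← integral_Ioc_eq_integral_Ioo,
      ← intervalIntegral.integral_of_le zero_le_one, integral_id]
    norm_num
  have h2 : ∫ t in Set.Ioi (0 : ℝ) ∩ Set.Ici 1, t * (τ / (τ + t ^ α))
      = ∫ t in Set.Ioi (1 : ℝ), t * (τ / (τ + t ^ α)) := by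
    rw [Set.inter_eq_right.2 (Set.Ici_subset_Ioi.2 zero_lt_one), integral_Ici_eq_integral_Ioi]
  rw [hv, h1, h2]
  congr 1
  simp only [nsmul_eq_mul, smul_eq_mul]
  push_cast
  ring

end Obstruction

/-! ### The coverage formula, including `τ = 0` -/

namespace MacroTier

variable {Ω : Type*} [MeasurableSpace Ω] {μ : Measure Ω} (T : MacroTier μ) {f : ℕ} {τ : ℝ}

theorem coverage_eq_of_pos [IsProbabilityMeasure μ] (hnoise : T.sigmaSq = 0)
    (hf : f ∈ Finset.Icc 1 T.Hc) (hτ : 0 < τ) :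
    T.coverage f τ = T.p f / (T.p f * hypS T.α 1 0 τ + (1 - T.p f) * gammaDelta T.α 1 τ) := by
  have hp0 := T.p_nonneg hf
  have hp1 := T.p_le_one hf
  refine T.coverage_eq_div hnoise hf hτ ?_ (obstruction_eq T.two_lt_α hτ hp0 hp1)
  have h1 := one_le_hypS T.two_lt_α hτ
  have h2 := gammaDelta_pos T.two_lt_α hτ
  rcases hp0.eq_or_lt with h | h
  · rw [← h]; simpa using h2
  · have := mul_pos h (zero_lt_one.trans_le h1)
    have := mul_nonneg (sub_nonneg.2 hp1) h2.le
    linarith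

theorem iUnion_successEvent_zero (f : ℕ) :
    ⋃ k : ℕ, ⋃ n, T.successEvent f (1 / ((k : ℝ) + 1)) n = ⋃ n, T.successEvent f 0 n := by
  ext ω
  simp only [Set.mem_iUnion, successEvent, Set.mem_ofPred_eq]
  constructor
  · rintro ⟨k, n, hn, hlt⟩
    exact ⟨n, hn, lt_of_le_of_lt (ENNReal.ofReal_le_ofReal (by positivity)) hlt⟩
  · rintro ⟨n, hn, hlt⟩
    have ht : Tendsto (fun k : ℕ => ENNReal.ofReal (1 / ((k : ℝ) + 1))) atTop
        (𝓝 (ENNReal.ofReal 0)) :=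
      ENNReal.tendsto_ofReal tendsto_one_div_add_atTop_nhds_zero_nat
    obtain ⟨k, hk⟩ := (ht.eventually_lt_const hlt).exists
    exact ⟨k, n, hn, hk⟩

/-- The success events grow as the threshold decreases to zero, so continuity of measure from below
applies. -/
theorem tendsto_coverage_zero [IsProbabilityMeasure μ] (f : ℕ) :
    Tendsto (fun k : ℕ => T.coverage f (1 / ((k : ℝ) + 1))) atTop (𝓝 (T.coverage f 0)) := by
  simp_rw [coverage_eq_measure_iUnion]
  rw [← T.iUnion_successEvent_zero f]
  refine (ENNReal.tendsto_toReal (measure_ne_top _ _)).comp (tendsto_measure_iUnion_atTop ?_)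
  intro j k hjk
  refine Set.iUnion_mono fun n ω hω => ⟨hω.1, lt_of_le_of_lt (ENNReal.ofReal_le_ofReal ?_) hω.2⟩
  exact one_div_le_one_div_of_le (by positivity) (by exact_mod_cast Nat.succ_le_succ hjk)

theorem coverage_eq [IsProbabilityMeasure μ] (hnoise : T.sigmaSq = 0)
    (hf : f ∈ Finset.Icc 1 T.Hc) (hτ : 0 ≤ τ) (hpτ : 0 < T.p f ∨ 0 < τ) :
    T.coverage f τ = T.p f / (T.p f * hypS T.α 1 0 τ + (1 - T.p f) * gammaDelta T.α 1 τ) := by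
  rcases hτ.eq_or_lt with rfl | hτ
  swap
  · exact T.coverage_eq_of_pos hnoise hf hτ
  have hp : 0 < T.p f := hpτ.resolve_right (lt_irrefl 0)
  have hα := T.two_lt_α
  have hα0 : 0 < T.α := by linarith
  have hS : ContinuousAt (fun τ : ℝ => hypContinuation T.α (-τ)) 0 := by
    have h := (analyticOnNhd_hypContinuation hα (-0) (by simp)).continuousAt
    exact h.comp continuous_neg.continuousAt
  have hD : ContinuousAt (fun τ : ℝ => gammaDelta T.α 1 τ) 0 := by
    unfold gammaDelta
    exact continuousAt_const.mul (Real.continuousAt_rpow_const 0 _ (Or.inr (by positivity)))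
  have hS0 : hypContinuation T.α (-0) = 1 := by simp [hypContinuation]
  have hD0 : gammaDelta T.α 1 0 = 0 := by
    have : 2 / T.α ≠ 0 := by positivity
    simp [gammaDelta, Real.zero_rpow this]
  -- At `τ = 0` the denominator is `p`, which is where `0 < p` is needed.
  have hcont : ContinuousAt (fun τ : ℝ => T.p f / (T.p f * hypContinuation T.α (-τ)
      + (1 - T.p f) * gammaDelta T.α 1 τ)) 0 := by
    refine ContinuousAt.div continuousAt_const
      ((continuousAt_const.mul hS).add (continuousAt_const.mul hD)) ?_
    rw [hS0, hD0]
    simpa using hp.ne'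
  have hlim := hcont.tendsto.comp (tendsto_one_div_add_atTop_nhds_zero_nat (𝕜 := ℝ))
  rw [hypS_one_zero hα (by norm_num)]
  refine tendsto_nhds_unique (T.tendsto_coverage_zero f) (hlim.congr fun k => ?_)
  have hk : (0 : ℝ) < 1 / ((k : ℝ) + 1) := by positivity
  rw [T.coverage_eq_of_pos hnoise hf hk, hypS_one_zero hα (by linarith)]
  rfl

end MacroTier

end

/-- The second part says that the noise-free coverage probability depends on the network only through
the path loss exponent and the caching probability of the requested file: two noise-free networks
that agree in these two have the same coverage probability, whatever their `lam`, `P`, `N`, `C`. -/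
theorem corollary4 {Ω : Type*} [MeasurableSpace Ω] (μ : Measure Ω) [IsProbabilityMeasure μ]
    (T : MacroTier μ) (hnoise : T.sigmaSq = 0)
    (f : ℕ) (hf : f ∈ Finset.Icc 1 T.Hc)
    (τ : ℝ) (hτ : 0 ≤ τ) (hpτ : 0 < T.p f ∨ 0 < τ) :
    T.coverage f τ =
        T.p f / (T.p f * hypS T.α macroNakagami 0 τ
          + (1 - T.p f) * gammaDelta T.α macroNakagami τ) ∧
      ∀ {Ω' : Type*} [MeasurableSpace Ω'] (μ' : Measure Ω') [IsProbabilityMeasure μ']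
        (T' : MacroTier μ'), T'.sigmaSq = 0 → f ∈ Finset.Icc 1 T'.Hc →
        T'.α = T.α → T'.p f = T.p f → T'.coverage f τ = T.coverage f τ := by
  have hT := T.coverage_eq hnoise hf hτ hpτ
  refine ⟨hT, ?_⟩
  intro Ω' _ μ' _ T' hnoise' hf' hα hp
  rw [hT, T'.coverage_eq hnoise' hf' hτ (by rwa [hp]), hα, hp]
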